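/- Let $G$ be a locally compact Hausdorff étale groupoid with unit space $G^{(0)}$, range and source maps $r,s$, and let $G$ act freely and continuously (on the left) on a compact Hausdorff space $X$: there are a continuous surjection $r_X:X\to G^{(0)}$ and a continuous map $(g,x)\mapsto gx$ from $\{(g,x)\in G\times X: s(g)=r_X(x)\}$ to $X$ with $r_X(gx)=r(g)$, $g(hx)=(gh)x$ and $r_X(x)x=x$, and $gx=x$ implies $g=r_X(x)$. For $u\in G^{(0)}$ put $A(u)=C(r_X^{-1}(u))$; let $\mathcal A=\bigsqcup_u A(u)$ carry the bundle topology generated by the sets $\{b\in A(u): u\in U,\ \|b-a|_{r_X^{-1}(u)}\|<\varepsilon\}$ ($a\in C(X)$, $U\subset G^{(0)}$ open, $\varepsilon>0$); for $g\in G$ let $\alpha_g:A(s(g))\to A(r(g))$, $\alpha_g(f)(x)=f(g^{-1}x)$. Let $\Gamma_c(G,r^*\mathcal A)$ be the $*$-algebra of continuous compactly supported sections $f$, $f(g)\in A(r(g))$, with $$(f*k)(h)=\sum_{t\in G^{r(h)}}f(t)\,\alpha_t(k(t^{-1}h)),\qquad f^*(h)=\alpha_h(f(h^{-1})^*).$$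 For a unit $u$ and a unital $*$-representation $\pi$ of $A(u)$ on a (separable) Hilbert space $H$ let $L_\pi$ be the representation of $\Gamma_c(G,r^*\mathcal A)$ on $\ell^2(s^{-1}(u),H)$ given by $$(L_\pi(f)\xi)(g)=\sum_{t\in G^{r(g)}}\pi\big(\alpha_g^{-1}(f(t))\big)\,\xi(t^{-1}g).$$ The reduced crossed product $C(X)\rtimes_rG$ is the completion of $\Gamma_c(G,r^*\mathcal A)$ in the norm $\|f\|_r=\sup_{u,\pi}\|L_\pi(f)\|$. It contains $C(X)$: a function is identified with the section supported on $G^{(0)}$ whose value at $u$ is its restriction to $r_X^{-1}(u)$. Let $B\subset C(X)\rtimes_rG$ be a unital subalgebra (closed and self-adjoint or not) such that (i) $C(X)\subset B$; and (ii) $B\cap\Gamma_c(G,r^*\mathcal A)$ is dense in $B$. Let $a\in B$ be nonzero and positive in $C(X)\rtimes_rG$. Then there is a nonzero positive $b\in C(X)$ with $b\precsim_Ba$, i.e. there is a sequence $(r_n)_{n\in\mathbb N}$ in $B$ such that $b=\lim_{n\to\infty}r_n a r_n^*$ in norm. -/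

import Mathlib

open Set Filter Topology
open scoped ENNReal

/-- An étale topological groupoid with space of arrows `G` and unit space `G₀`. The unit space is
a separate type, embedded into `G` by `unit` (an embedding, since `r` is a continuous left inverse
of it). The product `mul g h` is only meaningful when `s g = r h`; its values on other pairs are
unconstrained and never used. -/
structure EtaleGroupoid (G G₀ : Type*) [TopologicalSpace G] [TopologicalSpace G₀] where
  r : G → G₀
  s : G → G₀
  unit : G₀ → G
  mul : G → G → G
  inv : G → G
  r_unit : ∀ u, r (unit u) = u
  s_unit : ∀ u, s (unit u) = u
  r_mul : ∀ g h, s g = r h → r (mul g h) = r g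
  s_mul : ∀ g h, s g = r h → s (mul g h) = s h
  mul_assoc : ∀ g h k, s g = r h → s h = r k → mul (mul g h) k = mul g (mul h k)
  unit_mul : ∀ g, mul (unit (r g)) g = g
  mul_unit : ∀ g, mul g (unit (s g)) = g
  r_inv : ∀ g, r (inv g) = s g
  s_inv : ∀ g, s (inv g) = r g
  inv_mul : ∀ g, mul (inv g) g = unit (s g)
  mul_inv : ∀ g, mul g (inv g) = unit (r g)
  continuous_unit : Continuous unit
  continuous_inv : Continuous inv
  continuousOn_mul : ContinuousOn (fun p : G × G => mul p.1 p.2) {p | s p.1 = r p.2}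
  isLocalHomeomorph_r : IsLocalHomeomorph r
  isLocalHomeomorph_s : IsLocalHomeomorph s

namespace EtaleGroupoid

/-- A continuous left action of a groupoid on a space `X`, with continuous surjective anchor map
`rX : X → G₀`. The value `act g x` is only meaningful when `s g = rX x`; other values are
unconstrained and never used. -/
structure Action {G G₀ : Type*} [TopologicalSpace G] [TopologicalSpace G₀]
    (𝒢 : EtaleGroupoid G G₀) (X : Type*) [TopologicalSpace X] where
  rX : X → G₀
  act : G → X → X
  surjective_rX : Function.Surjective rX
  rX_act : ∀ g x, 𝒢.s g = rX x → rX (act g x) = 𝒢.r g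
  act_act : ∀ g h x, 𝒢.s g = 𝒢.r h → 𝒢.s h = rX x → act g (act h x) = act (𝒢.mul g h) x
  unit_act : ∀ x, act (𝒢.unit (rX x)) x = x
  continuous_rX : Continuous rX
  continuousOn_act : ContinuousOn (fun p : G × X => act p.1 p.2) {p | 𝒢.s p.1 = rX p.2}

namespace Action

theorem lp_tsum_enorm_sq {ι : Type*} {E : ι → Type*} [∀ i, NormedAddCommGroup (E i)]
    (h : lp E 2) :
    ∑' p, ‖h p‖ₑ ^ 2 = ENNReal.ofReal (‖h‖ ^ 2) := by
  have h2 : (0 : ℝ) < (2 : ℝ≥0∞).toReal := by norm_num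
  have hs := lp.hasSum_norm h2 h
  simp only [ENNReal.toReal_ofNat, Real.rpow_ofNat] at hs
  rw [← hs.tsum_eq, ENNReal.ofReal_tsum_of_nonneg (fun _ => by positivity) hs.summable]
  simp only [← ofReal_norm, ENNReal.ofReal_pow (norm_nonneg _)]

theorem lp_memℓp_of_tsum_le {ι : Type*} {E : ι → Type*} [∀ i, NormedAddCommGroup (E i)]
    {x : ∀ i, E i} {D : ℝ}
    (hx : ∑' p, ‖x p‖ₑ ^ 2 ≤ ENNReal.ofReal D) : Memℓp x 2 := by
  have h1 : ∑' p, ((‖x p‖₊ ^ 2 : NNReal) : ℝ≥0∞) ≠ ⊤ := by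
    simp only [ENNReal.coe_pow, ← enorm_eq_nnnorm]
    exact ne_top_of_le_ne_top ENNReal.ofReal_ne_top hx
  have h2 := NNReal.summable_coe.mpr (ENNReal.tsum_coe_ne_top_iff_summable.mp h1)
  refine memℓp_gen ?_
  simpa using h2

theorem lp_norm_sq_le_of_tsum_le {ι : Type*} {E : ι → Type*} [∀ i, NormedAddCommGroup (E i)]
    {h : lp E 2} {D : ℝ} (hD : 0 ≤ D)
    (hx : ∑' p, ‖h p‖ₑ ^ 2 ≤ ENNReal.ofReal D) : ‖h‖ ^ 2 ≤ D := by
  rw [lp_tsum_enorm_sq] at hx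
  exact (ENNReal.ofReal_le_ofReal_iff hD).mp hx

section Defs

variable {G G₀ X : Type*} [TopologicalSpace G] [TopologicalSpace G₀] [TopologicalSpace X]
  {𝒢 : EtaleGroupoid G G₀}

/-- The action is free: only units have fixed points. -/
def IsFree (α : 𝒢.Action X) : Prop :=
  ∀ (g : G) (x : X), 𝒢.s g = α.rX x → α.act g x = x → g = 𝒢.unit (α.rX x)

/-- The fibre `r_X⁻¹(u)` of `X` over a unit `u`. -/
abbrev Fibre (α : 𝒢.Action X) (u : G₀) : Type _ := {x : X // α.rX x = u}

theorem isClosed_fibre [T2Space G₀] (α : 𝒢.Action X) (u : G₀) :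
    IsClosed {x : X | α.rX x = u} :=
  isClosed_eq α.continuous_rX continuous_const

instance compactSpace_fibre [T2Space G₀] [CompactSpace X] (α : 𝒢.Action X) (u : G₀) :
    CompactSpace (α.Fibre u) :=
  isCompact_iff_compactSpace.mp (α.isClosed_fibre u).isCompact

/-- The image `a(u)` of `a ∈ C(X)` in the fibre algebra `A(u) = C(r_X⁻¹(u))`. -/
noncomputable def restr (α : 𝒢.Action X) (a : C(X, ℂ)) (u : G₀) : C(α.Fibre u, ℂ) :=
  ⟨fun x => a x.1, a.continuous.comp continuous_subtype_val⟩

/-- The homeomorphism `r_X⁻¹(u) → r_X⁻¹(v)`, `x ↦ g x`, for an arrow `g` from `u` to `v`. -/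
def translate (α : 𝒢.Action X) {u v : G₀} (g : G) (hs : 𝒢.s g = u) (hr : 𝒢.r g = v) :
    C(α.Fibre u, α.Fibre v) where
  toFun x := ⟨α.act g x.1, (α.rX_act g x.1 (hs.trans x.2.symm)).trans hr⟩
  continuous_toFun := by
    refine Continuous.subtype_mk ?_ _
    have h : Continuous (fun x : α.Fibre u =>
        (⟨(g, x.1), hs.trans x.2.symm⟩ : {p : G × X | 𝒢.s p.1 = α.rX p.2})) :=
      Continuous.subtype_mk (continuous_const.prodMk continuous_subtype_val) _
    exact (continuousOn_iff_continuous_domRestrict.mp α.continuousOn_act).comp h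

/-- The inverse `α_g⁻¹ : A(v) → A(u)` of the isomorphism `α_g : A(u) → A(v)`,
`α_g(f)(x) = f(g⁻¹ x)`, induced by an arrow `g` from `u` to `v`; that is,
`α_g⁻¹(f)(x) = f(g x)`. -/
noncomputable def pull (α : 𝒢.Action X) {u v : G₀} (g : G) (hs : 𝒢.s g = u) (hr : 𝒢.r g = v)
    (f : C(α.Fibre v, ℂ)) : C(α.Fibre u, ℂ) :=
  f.comp (α.translate g hs hr)

/-- The total space `𝒜 = ⨆ᵤ A(u)` of the bundle of C⋆-algebras over `G₀` associated to `C(X)`. -/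
structure Bundle (α : 𝒢.Action X) where
  base : G₀
  val : C(α.Fibre base, ℂ)

/-- A compact set meets the fibres of a local homeomorphism in boundedly many points. -/
theorem exists_card_bound {φ : G → G₀} (hφ : IsLocalHomeomorph φ) {K : Set G} (hK : IsCompact K) :
    ∃ N : ℕ, ∀ v : G₀, {t | t ∈ K ∧ φ t = v}.encard ≤ N := by
  refine IsCompact.induction_on (p := fun K => ∃ N : ℕ, ∀ v : G₀,
    {t | t ∈ K ∧ φ t = v}.encard ≤ N) hK ⟨0, fun v => by simp⟩ ?_ ?_ ?_
  · rintro s t hst ⟨N, hN⟩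
    exact ⟨N, fun v => (Set.encard_le_encard
      (show {x | x ∈ s ∧ φ x = v} ⊆ {x | x ∈ t ∧ φ x = v} from
        fun _ hx => ⟨hst hx.1, hx.2⟩)).trans (hN v)⟩
  · rintro s t ⟨N, hN⟩ ⟨M, hM⟩
    refine ⟨N + M, fun v => ?_⟩
    refine le_trans (Set.encard_le_encard (t := {x | x ∈ s ∧ φ x = v} ∪ {x | x ∈ t ∧ φ x = v}) ?_)
      ((Set.encard_union_le _ _).trans ((add_le_add (hN v) (hM v)).trans (by simp)))
    rintro x ⟨h | h, h'⟩
    · exact Or.inl ⟨h, h'⟩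
    · exact Or.inr ⟨h, h'⟩
  · intro x _
    obtain ⟨e, hx, he⟩ := hφ x
    refine ⟨e.source, mem_nhdsWithin_of_mem_nhds (e.open_source.mem_nhds hx), 1, fun v => ?_⟩
    rw [Nat.cast_one, Set.encard_le_one_iff]
    rintro a b ⟨ha, ha'⟩ ⟨hb, hb'⟩
    refine e.injOn ha hb ?_
    rw [← he]; exact ha'.trans hb'.symm

variable [T2Space G₀] [CompactSpace X]

/-- The topology of the bundle, generated by the tubes
`W(a, U, ε) = {b ∈ A(u) : u ∈ U, ‖b - a(u)‖ < ε}` with `a ∈ C(X)`, `U ⊆ G₀` open, `ε > 0`. -/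
noncomputable instance (α : 𝒢.Action X) : TopologicalSpace α.Bundle :=
  TopologicalSpace.generateFrom
    {W | ∃ (a : C(X, ℂ)) (U : Set G₀) (ε : ℝ), IsOpen U ∧ 0 < ε ∧
      W = {b : α.Bundle | b.base ∈ U ∧ ‖b.val - α.restr a b.base‖ < ε}}

/-- `Γ_c(G, r⋆𝒜)`: continuous compactly supported sections of the pull-back of the bundle `𝒜`
along the range map. -/
structure Section (α : 𝒢.Action X) where
  toFun : (g : G) → C(α.Fibre (𝒢.r g), ℂ)
  continuous_toFun : Continuous (fun g => (⟨𝒢.r g, toFun g⟩ : α.Bundle))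
  isCompact_support : IsCompact (closure {g | toFun g ≠ 0})

/-- A (unital, hence nondegenerate) representation `π` of a fibre algebra `A(u)` on a Hilbert
space `H`. -/
structure FibreRep (α : 𝒢.Action X) where
  u : G₀
  H : Type
  [normed : NormedAddCommGroup H]
  [inner : InnerProductSpace ℂ H]
  [complete : CompleteSpace H]
  π : C(α.Fibre u, ℂ) →⋆ₐ[ℂ] (H →L[ℂ] H)

attribute [instance] FibreRep.normed FibreRep.inner FibreRep.complete

/-- An index of the Hilbert space of the regular representation: a unit `u`, a representation `π`
of `A(u)`, and an arrow `g` with source `u`. -/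
structure RegIndex (α : 𝒢.Action X) where
  rep : α.FibreRep
  g : G
  hg : 𝒢.s g = rep.u

/-- The Hilbert space `⨁_{(u, π)} ℓ²(G_u, H_π)`, the sum over all units `u` and all
representations `π` of `A(u)`. -/
abbrev RegSpace (α : 𝒢.Action X) : Type _ := lp (fun p : α.RegIndex => p.rep.H) 2

/-- `(u, π, g) ↦ (u, π, t⁻¹ g)`, for `r t = r g`. -/
def RegIndex.shift {α : 𝒢.Action X} (p : α.RegIndex) (t : G) (ht : 𝒢.r t = 𝒢.r p.g) :
    α.RegIndex where
  rep := p.rep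
  g := 𝒢.mul (𝒢.inv t) p.g
  hg := (𝒢.s_mul _ _ ((𝒢.s_inv t).trans ht)).trans p.hg

/-- The integrated left regular representations, all at once:
`(L_π(f) h)(g) = ∑_{t ∈ G^{r(g)}} π(α_g⁻¹(f(t))) h(t⁻¹ g)` for `h ∈ ℓ²(G_u, H_π)`.
The sum has only finitely many nonzero terms. -/
noncomputable def regFun {α : 𝒢.Action X} (f : α.Section) (h : ∀ p : α.RegIndex, p.rep.H)
    (p : α.RegIndex) : p.rep.H :=
  ∑ᶠ t : {t : G // 𝒢.r t = 𝒢.r p.g},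
    p.rep.π (α.pull p.g p.hg t.2.symm (f.toFun t.1)) (h (p.shift t.1 t.2))

/-- Continuous compactly supported sections are bounded. -/
theorem Section.exists_bound [T2Space X] {α : 𝒢.Action X} (f : α.Section) :
    ∃ M : NNReal, ∀ t, ‖f.toFun t‖₊ ≤ M := by
  have key : ∃ M : NNReal, ∀ t ∈ closure {g | f.toFun g ≠ 0}, ‖f.toFun t‖₊ ≤ M := by
    refine IsCompact.induction_on (p := fun K => ∃ M : NNReal, ∀ t ∈ K, ‖f.toFun t‖₊ ≤ M)
      f.isCompact_support ⟨0, by simp⟩ ?_ ?_ ?_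
    · rintro s t hst ⟨M, hM⟩
      exact ⟨M, fun x hx => hM x (hst hx)⟩
    · rintro s t ⟨M, hM⟩ ⟨N, hN⟩
      refine ⟨max M N, ?_⟩
      rintro x (hx | hx)
      · exact (hM x hx).trans (le_max_left _ _)
      · exact (hN x hx).trans (le_max_right _ _)
    · intro g _
      obtain ⟨a, ha⟩ := ContinuousMap.exists_restrict_eq (α.isClosed_fibre (𝒢.r g)) (f.toFun g)
      have ha' : α.restr a (𝒢.r g) = f.toFun g := ha
      let W : Set α.Bundle := {b | b.base ∈ (univ : Set G₀) ∧ ‖b.val - α.restr a b.base‖ < 1}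
      have hW : IsOpen W := TopologicalSpace.isOpen_generateFrom_of_mem
        ⟨a, univ, 1, isOpen_univ, one_pos, rfl⟩
      refine ⟨_, mem_nhdsWithin_of_mem_nhds ((hW.preimage f.continuous_toFun).mem_nhds ?_),
        ‖a‖₊ + 1, ?_⟩
      · exact ⟨mem_univ _, by simp [ha']⟩
      · rintro t ⟨-, ht⟩
        have h1 : ‖α.restr a (𝒢.r t)‖ ≤ ‖a‖ :=
          (ContinuousMap.norm_le _ (norm_nonneg _)).mpr fun x => a.norm_coe_le_norm x.1
        have h2 : ‖f.toFun t‖ ≤ ‖f.toFun t - α.restr a (𝒢.r t)‖ + ‖α.restr a (𝒢.r t)‖ := by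
          simpa using norm_add_le (f.toFun t - α.restr a (𝒢.r t)) (α.restr a (𝒢.r t))
        have h3 : ‖f.toFun t - α.restr a (𝒢.r t)‖ < 1 := ht
        rw [← NNReal.coe_le_coe]
        push_cast
        linarith
  obtain ⟨M, hM⟩ := key
  refine ⟨M, fun t => ?_⟩
  by_cases ht : f.toFun t = 0
  · simp [ht]
  · exact hM t (subset_closure ht)

/-- `L(f)` is bounded for the `ℓ²`-norm. -/
theorem regFun_bound [T2Space X] {α : 𝒢.Action X} (f : α.Section) :
    ∃ C : NNReal, ∀ h : (∀ p : α.RegIndex, p.rep.H),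
      ∑' p, ‖regFun f h p‖ₑ ^ 2 ≤ C * ∑' p, ‖h p‖ₑ ^ 2 := by
  obtain ⟨M, hM⟩ := f.exists_bound
  set K := closure {g | f.toFun g ≠ 0} with hK
  obtain ⟨N, hN⟩ := exists_card_bound 𝒢.isLocalHomeomorph_r f.isCompact_support
  obtain ⟨N', hN'⟩ := exists_card_bound 𝒢.isLocalHomeomorph_s f.isCompact_support
  refine ⟨N * M ^ 2 * N', fun h => ?_⟩
  have hpt : ∀ p : α.RegIndex, ‖regFun f h p‖ₑ ^ 2 ≤
      (N * M ^ 2 : NNReal) * ∑' t : {t | t ∈ K ∧ 𝒢.r t = 𝒢.r p.g},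
        ‖h (p.shift t.1 t.2.2)‖ₑ ^ 2 := by
    intro p
    have hfin : {t | t ∈ K ∧ 𝒢.r t = 𝒢.r p.g}.Finite :=
      Set.finite_of_encard_le_coe (hN _)
    let _ : Fintype {t | t ∈ K ∧ 𝒢.r t = 𝒢.r p.g} := hfin.fintype
    have hcard : Fintype.card {t | t ∈ K ∧ 𝒢.r t = 𝒢.r p.g} ≤ N := by
      have := hN (𝒢.r p.g)
      rw [Set.encard_eq_coe_toFinset_card, Set.toFinset_card] at this
      exact_mod_cast this
    let e : {t | t ∈ K ∧ 𝒢.r t = 𝒢.r p.g} ↪ {t : G // 𝒢.r t = 𝒢.r p.g} :=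
      ⟨fun t => ⟨t.1, t.2.2⟩, fun a b hab => Subtype.ext (by simpa using hab)⟩
    have hsum : regFun f h p = ∑ t : {t | t ∈ K ∧ 𝒢.r t = 𝒢.r p.g},
        p.rep.π (α.pull p.g p.hg t.2.2.symm (f.toFun t.1)) (h (p.shift t.1 t.2.2)) := by
      unfold regFun
      rw [finsum_eq_sum_of_support_subset (s := Finset.univ.map e), Finset.sum_map]
      · rfl
      · intro t ht
        have h0 : f.toFun t.1 ≠ 0 := by
          intro h0
          apply ht
          have : α.pull p.g p.hg t.2.symm (f.toFun t.1) = 0 := by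
            ext x; simp [pull, h0]
          simp only [this, map_zero]
          rfl
        simp only [Finset.coe_map, Finset.coe_univ, Set.image_univ]
        exact ⟨⟨t.1, subset_closure h0, t.2⟩, rfl⟩
    have hterm : ∀ t : {t | t ∈ K ∧ 𝒢.r t = 𝒢.r p.g},
        ‖p.rep.π (α.pull p.g p.hg t.2.2.symm (f.toFun t.1)) (h (p.shift t.1 t.2.2))‖₊
          ≤ M * ‖h (p.shift t.1 t.2.2)‖₊ := by
      intro t
      refine (ContinuousLinearMap.le_opNNNorm _ _).trans ?_
      refine mul_le_mul_left ?_ _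
      refine le_trans ?_ (hM t.1)
      have h1 : ‖p.rep.π (α.pull p.g p.hg t.2.2.symm (f.toFun t.1))‖ ≤
          ‖α.pull p.g p.hg t.2.2.symm (f.toFun t.1)‖ :=
        NonUnitalStarAlgHom.norm_apply_le p.rep.π _
      refine le_trans (b := ‖α.pull p.g p.hg t.2.2.symm (f.toFun t.1)‖₊) h1 ?_
      exact (ContinuousMap.norm_le _ (norm_nonneg _)).mpr fun x =>
        (f.toFun t.1).norm_coe_le_norm _
    have hreal : ‖regFun f h p‖₊ ^ 2 ≤ (N * M ^ 2 : NNReal) *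
        ∑ t : {t | t ∈ K ∧ 𝒢.r t = 𝒢.r p.g}, ‖h (p.shift t.1 t.2.2)‖₊ ^ 2 := by
      calc ‖regFun f h p‖₊ ^ 2
          ≤ (∑ t : {t | t ∈ K ∧ 𝒢.r t = 𝒢.r p.g}, M * ‖h (p.shift t.1 t.2.2)‖₊) ^ 2 := by
            gcongr
            rw [hsum]
            exact (nnnorm_sum_le _ _).trans (Finset.sum_le_sum fun t _ => hterm t)
        _ ≤ (Fintype.card {t | t ∈ K ∧ 𝒢.r t = 𝒢.r p.g} : NNReal) *
              ∑ t : {t | t ∈ K ∧ 𝒢.r t = 𝒢.r p.g}, (M * ‖h (p.shift t.1 t.2.2)‖₊) ^ 2 :=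
            sq_sum_le_card_mul_sum_sq
        _ ≤ N * ∑ t : {t | t ∈ K ∧ 𝒢.r t = 𝒢.r p.g}, (M * ‖h (p.shift t.1 t.2.2)‖₊) ^ 2 := by
            gcongr
        _ = _ := by
            simp only [mul_pow, ← Finset.mul_sum]
            rw [_root_.mul_assoc]
    have hen : ((‖regFun f h p‖₊ ^ 2 : NNReal) : ℝ≥0∞) ≤ ((N * M ^ 2 : NNReal) *
        ∑ t : {t | t ∈ K ∧ 𝒢.r t = 𝒢.r p.g}, ‖h (p.shift t.1 t.2.2)‖₊ ^ 2 : NNReal) :=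
      ENNReal.coe_le_coe.mpr hreal
    rw [tsum_fintype]
    rw [ENNReal.coe_mul, ENNReal.ofNNReal_finsetSum] at hen
    simpa only [ENNReal.coe_pow, enorm_eq_nnnorm] using hen
  let ι : (Σ p : α.RegIndex, {t | t ∈ K ∧ 𝒢.r t = 𝒢.r p.g}) →
      (Σ q : α.RegIndex, {t | t ∈ K ∧ 𝒢.s t = 𝒢.r q.g}) := fun x =>
    ⟨x.1.shift x.2.1 x.2.2.2, x.2.1, x.2.2.1, by
      have := 𝒢.r_mul (𝒢.inv x.2.1) x.1.g ((𝒢.s_inv _).trans x.2.2.2)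
      exact ((𝒢.r_inv _).symm.trans this.symm)⟩
  have hι : Function.Injective ι := by
    rintro ⟨⟨ρ, g, hg⟩, ⟨t, ht, ht'⟩⟩ ⟨⟨ρ', g', hg'⟩, ⟨t', hs, hs'⟩⟩ hx
    have h1 := congrArg (fun y => y.1.rep) hx
    have h2 := congrArg (fun y => y.2.1) hx
    have h3 := congrArg (fun y => y.1.g) hx
    simp only [ι, RegIndex.shift] at h1 h2 h3 ht' hs'
    subst h1 h2
    have : ∀ k, 𝒢.r t = 𝒢.r k → 𝒢.mul t (𝒢.mul (𝒢.inv t) k) = k := by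
      intro k hk
      rw [← 𝒢.mul_assoc _ _ _ (𝒢.r_inv t).symm ((𝒢.s_inv t).trans hk), 𝒢.mul_inv, hk, 𝒢.unit_mul]
    have h4 : g = g' := by rw [← this g ht', ← this g' hs', h3]
    subst h4
    rfl
  calc ∑' p, ‖regFun f h p‖ₑ ^ 2
      ≤ ∑' p : α.RegIndex, (N * M ^ 2 : NNReal) * ∑' t : {t | t ∈ K ∧ 𝒢.r t = 𝒢.r p.g},
        ‖h (p.shift t.1 t.2.2)‖ₑ ^ 2 := ENNReal.tsum_le_tsum hpt
    _ = (N * M ^ 2 : NNReal) * ∑' x : (Σ p : α.RegIndex, {t | t ∈ K ∧ 𝒢.r t = 𝒢.r p.g}),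
        ‖h (ι x).1‖ₑ ^ 2 := by
      rw [ENNReal.tsum_mul_left, ENNReal.tsum_sigma']
    _ ≤ (N * M ^ 2 : NNReal) * ∑' y : (Σ q : α.RegIndex, {t | t ∈ K ∧ 𝒢.s t = 𝒢.r q.g}),
        ‖h y.1‖ₑ ^ 2 := by
      gcongr
      exact ENNReal.tsum_comp_le_tsum_of_injective hι (fun y => ‖h y.1‖ₑ ^ 2)
    _ ≤ (N * M ^ 2 : NNReal) * ∑' q : α.RegIndex, (N' : ℝ≥0∞) * ‖h q‖ₑ ^ 2 := by
      rw [ENNReal.tsum_sigma']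
      gcongr with q
      refine (ENNReal.tsum_const (‖h q‖ₑ ^ 2)).trans_le ?_
      gcongr
      exact_mod_cast hN' (𝒢.r q.g)
    _ = _ := by
      rw [ENNReal.tsum_mul_left, ← _root_.mul_assoc]
      push_cast
      rfl

theorem finite_support_regFun {α : 𝒢.Action X} (f : α.Section) (h : ∀ p : α.RegIndex, p.rep.H)
    (p : α.RegIndex) :
    (Function.support fun t : {t : G // 𝒢.r t = 𝒢.r p.g} =>
      p.rep.π (α.pull p.g p.hg t.2.symm (f.toFun t.1)) (h (p.shift t.1 t.2))).Finite := by
  obtain ⟨N, hN⟩ := exists_card_bound 𝒢.isLocalHomeomorph_r f.isCompact_support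
  refine ((Set.finite_of_encard_le_coe (hN (𝒢.r p.g))).preimage
    Subtype.val_injective.injOn).subset ?_
  intro t ht
  refine ⟨subset_closure fun h0 => ht ?_, t.2⟩
  have : α.pull p.g p.hg t.2.symm (f.toFun t.1) = 0 := by
    ext x; simp [pull, h0]
  simp only [this, map_zero]
  rfl

/-- The operator `L(f) = ⨁_{(u, π)} L_π(f)` on `⨁_{(u, π)} ℓ²(G_u, H_π)`. Its norm is the reduced
norm `sup_{(u, π)} ‖L_π(f)‖` of `f`. -/
noncomputable def regRep [T2Space X] (α : 𝒢.Action X) (f : α.Section) :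
    α.RegSpace →L[ℂ] α.RegSpace :=
  have key : ∃ C : NNReal, ∀ h : α.RegSpace,
      ∑' p, ‖regFun f h p‖ₑ ^ 2 ≤ ENNReal.ofReal (C * ‖h‖ ^ 2) := by
    obtain ⟨C, hC⟩ := regFun_bound f
    refine ⟨C, fun h => (hC h).trans_eq ?_⟩
    rw [lp_tsum_enorm_sq, ENNReal.ofReal_mul C.coe_nonneg, ENNReal.ofReal_coe_nnreal]
  LinearMap.mkContinuousOfExistsBound
    { toFun := fun h => ⟨regFun f h, lp_memℓp_of_tsum_le (key.choose_spec h)⟩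
      map_add' := fun h k => by
        refine lp.ext (funext fun p => ?_)
        change regFun f ⇑(h + k) p = regFun f h p + regFun f k p
        unfold regFun
        rw [← finsum_add_distrib (finite_support_regFun f h p) (finite_support_regFun f k p)]
        exact finsum_congr fun t => map_add _ _ _
      map_smul' := fun c h => by
        refine lp.ext (funext fun p => ?_)
        change regFun f ⇑(c • h) p = c • regFun f h p
        unfold regFun
        rw [smul_finsum' _ (finite_support_regFun f h p)]
        exact finsum_congr fun t => map_smul _ _ _ }
    (by
      obtain ⟨C, hC⟩ := key
      refine ⟨Real.sqrt C, fun h => ?_⟩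
      have h1 := lp_norm_sq_le_of_tsum_le (by positivity)
        (h := (⟨regFun f h, lp_memℓp_of_tsum_le (hC h)⟩ : α.RegSpace)) (hC h)
      refine (pow_le_pow_iff_left₀ (norm_nonneg _) (by positivity) two_ne_zero).mp ?_
      rw [mul_pow, Real.sq_sqrt C.coe_nonneg]
      exact h1)

theorem regRep_apply [T2Space X] (α : 𝒢.Action X) (f : α.Section) (h : α.RegSpace)
    (p : α.RegIndex) : regRep α f h p = regFun f h p := rfl

/-- The reduced crossed product `C(X) ⋊_r G`: the completion of `Γ_c(G, r⋆𝒜)` in the reduced norm,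
realised as the C⋆-algebra generated by the operators `L(f)`, `f ∈ Γ_c(G, r⋆𝒜)`. Composition and
adjoint of these operators implement the convolution
`(f * k)(h) = ∑_{t ∈ G^{r(h)}} f(t) α_t(k(t⁻¹ h))` and the involution `f⋆(h) = α_h(f(h⁻¹)⋆)`; in
particular their range is a unital ⋆-subalgebra, and the crossed product is its norm closure. -/
noncomputable def crossedProduct [T2Space X] (α : 𝒢.Action X) :
    StarSubalgebra ℂ (α.RegSpace →L[ℂ] α.RegSpace) :=
  (StarAlgebra.adjoin ℂ (Set.range (regRep α))).topologicalClosure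

/-- The canonical map `Γ_c(G, r⋆𝒜) → C(X) ⋊_r G`. -/
noncomputable def ofSection [T2Space X] (α : 𝒢.Action X) (f : α.Section) : α.crossedProduct :=
  ⟨regRep α f, StarSubalgebra.le_topologicalClosure _
    (StarAlgebra.subset_adjoin ℂ _ (Set.mem_range_self f))⟩

/-- Restricting a function on `X` to the fibres gives a continuous section of `𝒜`. -/
theorem continuous_restr (α : 𝒢.Action X) (a : C(X, ℂ)) :
    Continuous (fun u => (⟨u, α.restr a u⟩ : α.Bundle)) := by
  refine continuous_generateFrom_iff.mpr ?_
  rintro _ ⟨b, U, ε, hU, hε, rfl⟩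
  have hcl : IsClosed (α.rX '' {x | ε ≤ ‖a x - b x‖}) :=
    ((isClosed_le continuous_const (by fun_prop)).isCompact.image α.continuous_rX).isClosed
  convert hU.inter hcl.isOpen_compl using 1
  ext u
  simp only [mem_preimage, mem_ofPred_eq, mem_inter_iff, mem_compl_iff, mem_image, not_exists,
    not_and, ContinuousMap.norm_lt_iff _ hε]
  refine and_congr_right fun _ => ⟨fun h x hx hu => ?_, fun h x => ?_⟩
  · exact absurd (h ⟨x, hu⟩) (not_lt.mpr hx)
  · by_contra hx
    exact h x.1 (not_lt.mp hx) x.2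

end Defs

end Action

section Unit

variable {G G₀ : Type*} [TopologicalSpace G] [TopologicalSpace G₀]

theorem isOpen_range_unit (𝒢 : EtaleGroupoid G G₀) : IsOpen (range 𝒢.unit) := by
  rw [isOpen_iff_mem_nhds]
  rintro _ ⟨u, rfl⟩
  obtain ⟨e, he, hs⟩ := 𝒢.isLocalHomeomorph_s (𝒢.unit u)
  have hc : Continuous fun g => 𝒢.unit (𝒢.s g) :=
    𝒢.continuous_unit.comp 𝒢.isLocalHomeomorph_s.continuous
  have h1 : e.source ∈ 𝓝 (𝒢.unit u) := e.open_source.mem_nhds he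
  have h2 : (fun g => 𝒢.unit (𝒢.s g)) ⁻¹' e.source ∈ 𝓝 (𝒢.unit u) :=
    hc.continuousAt.preimage_mem_nhds (by simpa only [𝒢.s_unit] using h1)
  filter_upwards [h1, h2] with g hg hg'
  refine ⟨𝒢.s g, e.injOn hg' hg ?_⟩
  rw [← hs, 𝒢.s_unit]

theorem isClosed_range_unit [T2Space G] (𝒢 : EtaleGroupoid G G₀) : IsClosed (range 𝒢.unit) := by
  have : range 𝒢.unit = {g | 𝒢.unit (𝒢.s g) = g} := by
    ext g
    exact ⟨by rintro ⟨u, rfl⟩; simp only [mem_ofPred_eq, 𝒢.s_unit], fun h => ⟨_, h⟩⟩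
  rw [this]
  exact isClosed_eq (𝒢.continuous_unit.comp 𝒢.isLocalHomeomorph_s.continuous) continuous_id

end Unit

namespace Action

section Functions

variable {G G₀ X : Type*} [TopologicalSpace G] [TopologicalSpace G₀] [TopologicalSpace X]
  {𝒢 : EtaleGroupoid G G₀} [T2Space G₀] [CompactSpace X] [T2Space G]

open Classical in
/-- The inclusion `C(X) ⊆ Γ_c(G, r⋆𝒜)`: the function `a` is the section supported on the units
whose value at a unit `u` is `a(u) ∈ A(u)`. -/
noncomputable def ofFunction (α : 𝒢.Action X) (a : C(X, ℂ)) : α.Section where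
  toFun g := if g ∈ range 𝒢.unit then α.restr a (𝒢.r g) else 0
  continuous_toFun := by
    have h0 : ∀ u, α.restr 0 u = 0 := fun u => rfl
    have : (fun g => (⟨𝒢.r g, if g ∈ range 𝒢.unit then α.restr a (𝒢.r g) else 0⟩ : α.Bundle)) =
        fun g => if g ∈ range 𝒢.unit then (⟨𝒢.r g, α.restr a (𝒢.r g)⟩ : α.Bundle)
          else ⟨𝒢.r g, α.restr 0 (𝒢.r g)⟩ := by
      funext g
      split_ifs <;> rfl
    rw [this]
    refine continuous_if ?_ ?_ ?_
    · have hcl : IsClopen {g | g ∈ range 𝒢.unit} := ⟨𝒢.isClosed_range_unit, 𝒢.isOpen_range_unit⟩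
      intro g hg
      rw [hcl.frontier_eq] at hg
      exact hg.elim
    · exact ((α.continuous_restr a).comp 𝒢.isLocalHomeomorph_r.continuous).continuousOn
    · exact ((α.continuous_restr 0).comp 𝒢.isLocalHomeomorph_r.continuous).continuousOn
  isCompact_support := by
    have hc : IsCompact (range 𝒢.unit) := by
      have h1 : IsCompact (range α.rX) := isCompact_range α.continuous_rX
      rw [α.surjective_rX.range_eq] at h1
      rw [← image_univ]
      exact h1.image 𝒢.continuous_unit
    refine hc.of_isClosed_subset isClosed_closure (closure_minimal ?_ 𝒢.isClosed_range_unit)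
    intro g hg
    by_contra h
    exact hg (if_neg h)

/-- The inclusion `C(X) ⊆ C(X) ⋊_r G`. -/
noncomputable def incl [T2Space X] (α : 𝒢.Action X) (a : C(X, ℂ)) : α.crossedProduct :=
  α.ofSection (α.ofFunction a)

end Functions

end Action
end EtaleGroupoid

/-- Positive elements of a C⋆-algebra. -/
def IsPositiveElem {A : Type*} [Mul A] [Star A] (a : A) : Prop :=
  ∃ c : A, a = star c * c

/-- Cuntz subequivalence of `a` to `b` over a subalgebra `B` of a C⋆-algebra `A`:
`a = lim rₙ b rₙ⋆` for a sequence `rₙ` in `B`. -/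
def CuntzSubequiv {A : Type*} [Ring A] [Algebra ℂ A] [Star A] [TopologicalSpace A]
    (B : Subalgebra ℂ A) (a b : A) : Prop :=
  ∃ r : ℕ → A, (∀ n, r n ∈ B) ∧ Tendsto (fun n => r n * b * star (r n)) atTop (𝓝 a)

/-! Write `δ_x` for the unit vector at the unit `r_X(x)` in the regular representation given by
evaluation at `x`. The function `x ↦ ⟨δ_x, T δ_x⟩` is the conditional expectation of `T`, and it
restricts a section to the units.

The expectation is faithful (`eq_zero_of_apply_pointVector_eq_zero`): the values of a section `f`
are the coefficients of the vectors `L(f) δ_x`, so if `T` kills every `δ_x`, sections near `T` are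
uniformly small and all matrix coefficients of `T` vanish. Hence `a = c⋆c ≠ 0` has `⟨δ_x, a δ_x⟩ =
‖c δ_x‖² = μ > 0` for some `x`.

Approximate `a` by a section `f` within `μ/4`. The support of `f` is compact and the action is free,
so its non-unital arrows move a small neighbourhood of `x` off itself (`IsFree.exists_mem_nhds`).
Cutting `f` down by a bump function `φ` supported there leaves only `φ² f|_{G⁽⁰⁾}`, which is close
to `μ φ²`. With `φ ψ = ψ` this gives `ψ a ψ ≥ (μ/4) ψ²` (`exists_smul_sq_le_conj`).

Finally put `e = ψ`, `y = e a e ≥ κ e²`. Since `e (1 - y (y + η)⁻¹) e = η e (y + η)⁻¹ e` has norm at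
most `η/κ`, polynomials `p` close to `(t + η)^(-1/2)` give `e p(y) y p(y) e → e²`. So `b = ψ²` works
with `rₙ = e pₙ(y) e`. Polynomials keep `rₙ` in `B`, which need not be closed, and self-adjointness
of `rₙ` removes any need for `B` to be closed under adjoints. -/

/-! ### Functional calculus: recovering `e²` from `y ≥ κ e²` -/

theorem norm_cfc_mul_sq_le {A : Type*} [CStarAlgebra A] [PartialOrder A] [StarOrderedRing A]
    {e y : A} (he : IsSelfAdjoint e) (hy : 0 ≤ y) {κ : ℝ} (hκ : 0 < κ) (hey : κ • (e * e) ≤ y)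
    {η : ℝ} (hη : 0 < η) :
    ‖e * cfc (fun t : ℝ => 1 / (t + η)) y * e‖ ≤ κ⁻¹ := by
  have hy' : IsSelfAdjoint y := .of_nonneg hy
  have hsp : ∀ t ∈ spectrum ℝ y, 0 ≤ t := fun t ht => spectrum_nonneg_of_nonneg hy ht
  set f : ℝ → ℝ := fun t => 1 / Real.sqrt (t + η) with hf
  have hfc : ContinuousOn f (spectrum ℝ y) := by
    refine continuousOn_const.div (by fun_prop) fun t ht => ?_
    have := hsp t ht
    positivity
  set F := cfc f y with hF
  have hFs : IsSelfAdjoint F := cfc_predicate f y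
  have h1 : cfc (fun t : ℝ => 1 / (t + η)) y = F * F := by
    rw [hF, ← cfc_mul f f y]
    refine cfc_congr fun t ht => ?_
    have := hsp t ht
    simp only [hf, ← sq, div_pow, one_pow]
    rw [Real.sq_sqrt (by positivity)]
  -- By the C⋆-identity, `(Fe)⋆(Fe)` has the same norm as `(Fe)(Fe)⋆ = F e² F`, and the latter is at
  -- most `κ⁻¹ F y F ≤ κ⁻¹`.
  have h2 : e * (F * F) * e = star (F * e) * (F * e) := by
    rw [star_mul, he.star_eq, hFs.star_eq]; simp only [mul_assoc]
  have h3 : F * y * F ≤ 1 := by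
    have : F * y * F = cfc (fun t => f t * t * f t) y := by
      rw [cfc_mul (fun t => f t * t) f y, cfc_mul f (fun t => t) y, cfc_id' ℝ y]
    rw [this]
    refine cfc_le_one _ _ fun t ht => ?_
    have := hsp t ht
    have h4 : f t * t * f t = t / (t + η) := by
      have : f t * f t = 1 / (t + η) := by
        simp only [hf, ← sq, div_pow, one_pow]
        rw [Real.sq_sqrt (by positivity)]
      rw [mul_right_comm, this]; ring
    rw [h4]
    exact div_le_one_of_le₀ (by linarith) (by positivity)
  have h5 : κ • (F * e * star (F * e)) ≤ 1 := by
    refine le_trans ?_ h3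
    have := hFs.conjugate_le_conjugate hey
    rw [star_mul, he.star_eq, hFs.star_eq]
    refine le_trans (le_of_eq ?_) this
    simp only [mul_smul_comm, smul_mul_assoc, mul_assoc]
  have h6 : ‖κ • (F * e * star (F * e))‖ ≤ 1 :=
    (CStarAlgebra.norm_le_one_iff_of_nonneg _
      (smul_nonneg hκ.le (mul_star_self_nonneg _))).mpr h5
  rw [norm_smul, Real.norm_of_nonneg hκ.le, CStarRing.norm_self_mul_star] at h6
  rw [h1, h2, CStarRing.norm_star_mul_self]
  rw [← one_div, le_div_iff₀' hκ]
  exact h6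

theorem exists_polynomial_conj_near {A : Type*} [CStarAlgebra A] [PartialOrder A]
    [StarOrderedRing A]
    {e y : A} (he : IsSelfAdjoint e) (hy : 0 ≤ y) {κ : ℝ} (hκ : 0 < κ) (hey : κ • (e * e) ≤ y)
    {ε : ℝ} (hε : 0 < ε) :
    ∃ p : Polynomial ℝ,
      ‖e * (Polynomial.aeval y p * y * Polynomial.aeval y p) * e - e * e‖ < ε := by
  have hy' : IsSelfAdjoint y := .of_nonneg hy
  have hsp : ∀ t ∈ spectrum ℝ y, 0 ≤ t := fun t ht => spectrum_nonneg_of_nonneg hy ht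
  -- Half of `ε` is for the regularisation error `η e (y + η)⁻¹ e`, the other half for the
  -- polynomial approximation, where `δ` bounds the error before conjugation by `e`.
  obtain ⟨η, hη, hηε⟩ : ∃ η > 0, η * κ⁻¹ < ε / 2 :=
    ⟨ε * κ / 4, by positivity, by field_simp; norm_num⟩
  obtain ⟨δ, hδ, hδε⟩ : ∃ δ > 0, ‖e‖ * δ * ‖e‖ < ε / 2 := by
    refine ⟨ε / (2 * (‖e‖ * ‖e‖ + 1)), by positivity, ?_⟩
    rw [mul_div_assoc', div_mul_eq_mul_div, div_lt_div_iff₀ (by positivity) (by positivity)]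
    nlinarith [norm_nonneg e]
  set M := ‖y‖ + 1 with hM
  have hMy : ∀ t ∈ spectrum ℝ y, t ∈ Icc 0 M := fun t ht =>
    ⟨hsp t ht, by
      have := spectrum.norm_le_norm_mul_of_mem ht
      have h1 : ‖(1 : A)‖ ≤ 1 := by
        rcases subsingleton_or_nontrivial A with h | h
        · simp [Subsingleton.elim (1 : A) 0]
        · simp
      have := le_trans (le_abs_self t) this
      nlinarith [norm_nonneg y]⟩
  have hM0 : 0 < M := by positivity
  set f : ℝ → ℝ := fun t => 1 / Real.sqrt (t + η) with hf
  have hfc : ContinuousOn f (Icc 0 M) := by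
    refine continuousOn_const.div (by fun_prop) fun t ht => ?_
    have := ht.1
    positivity
  set C := 1 / Real.sqrt η with hC
  have hC0 : 0 < C := by positivity
  -- If `|p - f| ≤ d ≤ 1` and `|f| ≤ C`, then `|t (p² - f²)| = |t (p - f)((p - f) + 2f)| ≤ M d (2C +
  -- 1)`.
  obtain ⟨d, hd, hd1, hdδ⟩ : ∃ d > 0, d ≤ 1 ∧ M * (d * (2 * C + 1)) ≤ δ := by
    refine ⟨min 1 (δ / (M * (2 * C + 1))), by positivity, min_le_left _ _, ?_⟩
    calc M * (min 1 (δ / (M * (2 * C + 1))) * (2 * C + 1))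
        ≤ M * (δ / (M * (2 * C + 1)) * (2 * C + 1)) := by gcongr; exact min_le_right _ _
      _ = δ := by field_simp
  obtain ⟨p, hp⟩ := exists_polynomial_near_of_continuousOn 0 M f hfc d hd
  refine ⟨p, ?_⟩
  rw [← cfc_polynomial p y]
  have h1 : cfc p.eval y * y * cfc p.eval y = cfc (fun t => p.eval t * t * p.eval t) y := by
    rw [cfc_mul (fun t => p.eval t * t) p.eval y, cfc_mul p.eval (fun t => t) y, cfc_id' ℝ y]
  -- As `t f(t)² = 1 - η/(t + η)`, the remainder `R` is `t (p² - f²)`.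
  set R : ℝ → ℝ := fun t => p.eval t * t * p.eval t - (1 - η * (1 / (t + η))) with hR
  have hcont : ContinuousOn (fun t : ℝ => 1 / (t + η)) (spectrum ℝ y) := by
    refine continuousOn_const.div (by fun_prop) fun t ht => ?_
    have := hsp t ht
    positivity
  have h2 : cfc (fun t => p.eval t * t * p.eval t) y
      = 1 - η • cfc (fun t : ℝ => 1 / (t + η)) y + cfc R y := by
    rw [← cfc_const_one ℝ y, ← cfc_smul η _ y hcont, ← cfc_sub _ _ y,
      ← cfc_add _ _ _]
    · refine cfc_congr fun t ht => ?_
      simp [hR]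
  have h3 : ‖cfc R y‖ ≤ δ := by
    refine norm_cfc_le hδ.le fun t ht => ?_
    have ht' := hMy t ht
    have ht0 := ht'.1
    have hft : f t * f t = 1 / (t + η) := by
      simp only [hf, ← sq, div_pow, one_pow]
      rw [Real.sq_sqrt (by positivity)]
    have hR' : R t = t * ((p.eval t - f t) * ((p.eval t - f t) + 2 * f t)) := by
      have : 1 - η * (1 / (t + η)) = t * (1 / (t + η)) := by
        have : t + η ≠ 0 := by positivity
        field_simp; ring
      simp only [hR]
      rw [this, ← hft]; ring
    have hfC : |f t| ≤ C := by
      rw [abs_of_nonneg (by positivity)]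
      simp only [hf, hC]
      gcongr
      linarith
    have hpd := (hp t ht').le
    rw [hR', Real.norm_eq_abs, abs_mul, abs_mul, abs_of_nonneg ht0]
    refine le_trans ?_ hdδ
    have : |p.eval t - f t + 2 * f t| ≤ 2 * C + 1 := by
      refine (abs_add_le _ _).trans ?_
      rw [abs_mul, abs_two]
      linarith
    have := ht'.2
    gcongr
  have h4 : e * (1 - η • cfc (fun t : ℝ => 1 / (t + η)) y + cfc R y) * e - e * e
      = e * cfc R y * e - η • (e * cfc (fun t : ℝ => 1 / (t + η)) y * e) := by
    simp only [mul_add, mul_sub, add_mul, sub_mul, mul_one, mul_smul_comm, smul_mul_assoc]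
    abel
  rw [h1, h2, h4]
  have h5 : ‖e * cfc R y * e‖ ≤ ‖e‖ * δ * ‖e‖ :=
    (norm_mul_le _ _).trans (mul_le_mul_of_nonneg_right
      ((norm_mul_le _ _).trans (by gcongr)) (norm_nonneg _))
  have h6 : ‖η • (e * cfc (fun t : ℝ => 1 / (t + η)) y * e)‖ ≤ η * κ⁻¹ := by
    rw [norm_smul, Real.norm_of_nonneg hη.le]
    gcongr
    exact norm_cfc_mul_sq_le he hy hκ hey hη
  linarith [norm_sub_le (e * cfc R y * e) (η • (e * cfc (fun t : ℝ => 1 / (t + η)) y * e))]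

/-- If `κ e² ≤ y`, then `e²` is a limit of elements `e p(y) y p(y) e`, with `p` a polynomial. -/
theorem exists_isSelfAdjoint_aeval_conj_near {A : Type*} [CStarAlgebra A] [PartialOrder A]
    [StarOrderedRing A] {e y : A} (he : IsSelfAdjoint e) {κ : ℝ} (hκ : 0 < κ)
    (hey : (κ : ℂ) • (e * e) ≤ y) {ε : ℝ} (hε : 0 < ε) :
    ∃ p : Polynomial ℂ, IsSelfAdjoint (Polynomial.aeval y p) ∧
      ‖e * (Polynomial.aeval y p * y * Polynomial.aeval y p) * e - e * e‖ < ε := by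
  have hey' : κ • (e * e) ≤ y := by rwa [Complex.coe_smul] at hey
  have hy : 0 ≤ y := by
    refine le_trans (smul_nonneg hκ.le ?_) hey'
    simpa only [he.star_eq] using star_mul_self_nonneg e
  obtain ⟨p, hp⟩ := exists_polynomial_conj_near he hy hκ hey' hε
  -- The coefficients are real and `y` is self-adjoint, so the value at `y` is self-adjoint.
  refine ⟨p.map (algebraMap ℝ ℂ), ?_, ?_⟩
  · rw [Polynomial.aeval_map_algebraMap, ← cfc_polynomial p y (.of_nonneg hy)]
    exact cfc_predicate p.eval y
  · simpa only [Polynomial.aeval_map_algebraMap] using hp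

/-! ### Matrix coefficients and faithfulness of the expectation -/

namespace EtaleGroupoid

section Algebra

variable {G G₀ : Type*} [TopologicalSpace G] [TopologicalSpace G₀] (𝒢 : EtaleGroupoid G G₀)

theorem inv_unit (u : G₀) : 𝒢.inv (𝒢.unit u) = 𝒢.unit u := by
  have h := 𝒢.inv_mul (𝒢.unit u)
  have h2 := 𝒢.mul_unit (𝒢.inv (𝒢.unit u))
  rw [𝒢.s_inv, 𝒢.r_unit] at h2
  rw [h2, 𝒢.s_unit] at h
  exact h

theorem mul_inv_mul_cancel {t g : G} (h : 𝒢.r t = 𝒢.r g) :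
    𝒢.mul t (𝒢.mul (𝒢.inv t) g) = g := by
  rw [← 𝒢.mul_assoc _ _ _ (𝒢.r_inv t).symm ((𝒢.s_inv t).trans h), 𝒢.mul_inv, h, 𝒢.unit_mul]

theorem mul_right_injective {t t' k : G} (ht : 𝒢.s t = 𝒢.r k) (ht' : 𝒢.s t' = 𝒢.r k)
    (h : 𝒢.mul t k = 𝒢.mul t' k) : t = t' := by
  have key : ∀ t, 𝒢.s t = 𝒢.r k → 𝒢.mul (𝒢.mul t k) (𝒢.inv k) = t := fun t ht => by
    rw [𝒢.mul_assoc _ _ _ ht (𝒢.r_inv k).symm, 𝒢.mul_inv, ← ht, 𝒢.mul_unit]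
  rw [← key t ht, h, key t' ht']

theorem inv_mul_injective {t t' g : G} (ht : 𝒢.r t = 𝒢.r g) (ht' : 𝒢.r t' = 𝒢.r g)
    (h : 𝒢.mul (𝒢.inv t) g = 𝒢.mul (𝒢.inv t') g) : t = t' := by
  have hr : ∀ t, 𝒢.r t = 𝒢.r g → 𝒢.r (𝒢.mul (𝒢.inv t) g) = 𝒢.s t := fun t ht => by
    rw [𝒢.r_mul _ _ ((𝒢.s_inv t).trans ht), 𝒢.r_inv]
  refine 𝒢.mul_right_injective (k := 𝒢.mul (𝒢.inv t) g) (hr t ht).symm ?_ ?_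
  · rw [h, hr t' ht']
  · rw [𝒢.mul_inv_mul_cancel ht, h, 𝒢.mul_inv_mul_cancel ht']

end Algebra

namespace Action

section Coefficients

variable {G G₀ X : Type*} [TopologicalSpace G] [TopologicalSpace G₀] [TopologicalSpace X]
  {𝒢 : EtaleGroupoid G G₀}

theorem act_inv_act (α : 𝒢.Action X) {g : G} {x : X} (h : 𝒢.r g = α.rX x) :
    α.act g (α.act (𝒢.inv g) x) = x := by
  rw [α.act_act _ _ _ (𝒢.r_inv g).symm ((𝒢.s_inv g).trans h), 𝒢.mul_inv, h, α.unit_act]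

/-- The space at an index depends only on its representation, so equal arrows can be exchanged under
a fixed `ρ` without a cast between Hilbert spaces. -/
theorem apply_regIndex_congr {α : 𝒢.Action X} (h : ∀ p : α.RegIndex, p.rep.H) (ρ : α.FibreRep)
    {g g' : G} (e : g = g') (hg : 𝒢.s g = ρ.u) (hg' : 𝒢.s g' = ρ.u) :
    (show ρ.H from h ⟨ρ, g, hg⟩) = h ⟨ρ, g', hg'⟩ := by
  subst e; rfl

/-- Evaluation at a point of `X`, as a one-dimensional representation of a fibre algebra. -/
noncomputable def pointRep (α : 𝒢.Action X) (x : X) : α.FibreRep where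
  u := α.rX x
  H := ℂ
  π := (StarAlgHom.ofId ℂ (ℂ →L[ℂ] ℂ)).comp
    (ContinuousMap.evalStarAlgHom ℂ ℂ (⟨x, rfl⟩ : α.Fibre (α.rX x)))

theorem pointRep_π_apply (α : 𝒢.Action X) (x : X) (f : C(α.Fibre (α.rX x), ℂ)) (z : ℂ) :
    (α.pointRep x).π f z = f ⟨x, rfl⟩ * z := rfl

theorem RegIndex.shift_injective {α : 𝒢.Action X} (p : α.RegIndex) {t t' : G}
    (ht : 𝒢.r t = 𝒢.r p.g) (ht' : 𝒢.r t' = 𝒢.r p.g) (h : p.shift t ht = p.shift t' ht') :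
    t = t' :=
  𝒢.inv_mul_injective ht ht' (congrArg RegIndex.g h)

/-- The index of the unit `rX x` in the summand of the regular representation given by the
evaluation at `x`. -/
noncomputable def pointIndex (α : 𝒢.Action X) (x : X) : α.RegIndex :=
  ⟨α.pointRep x, 𝒢.unit (α.rX x), 𝒢.s_unit _⟩

open Classical in
/-- The unit vector of the regular representation at the unit `rX x`, in the summand given by the
evaluation at `x`. -/
noncomputable def pointVector (α : 𝒢.Action X) (x : X) : α.RegSpace :=
  lp.single 2 (α.pointIndex x) (1 : ℂ)

theorem norm_single (α : 𝒢.Action X) [DecidableEq α.RegIndex] (p : α.RegIndex) (ξ : p.rep.H) :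
    ‖(lp.single 2 p ξ : α.RegSpace)‖ = ‖ξ‖ :=
  lp.norm_single (E := fun p : α.RegIndex => p.rep.H) two_pos p ξ

theorem norm_pointVector (α : 𝒢.Action X) (x : X) : ‖α.pointVector x‖ = 1 := by
  classical
  exact (α.norm_single (α.pointIndex x) (1 : ℂ)).trans (norm_one (α := ℂ))

theorem pointVector_apply_self (α : 𝒢.Action X) (x : X) :
    α.pointVector x (α.pointIndex x) = (1 : ℂ) := by
  classical
  exact lp.single_apply_self (E := fun p : α.RegIndex => p.rep.H) 2 (α.pointIndex x) (1 : ℂ)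

theorem pointVector_apply_ne (α : 𝒢.Action X) (x : X) {p : α.RegIndex} (hp : p ≠ α.pointIndex x) :
    α.pointVector x p = 0 := by
  classical
  exact lp.single_apply_ne (E := fun p : α.RegIndex => p.rep.H) 2 (α.pointIndex x) (1 : ℂ) hp

variable [CompactSpace X] [T2Space G₀]

theorem FibreRep.norm_π_apply_le {α : 𝒢.Action X} (ρ : α.FibreRep) (f : C(α.Fibre ρ.u, ℂ))
    {ε : ℝ} (hε : 0 ≤ ε) (hf : ∀ x, ‖f x‖ ≤ ε) (ξ : ρ.H) : ‖ρ.π f ξ‖ ≤ ε * ‖ξ‖ := by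
  refine ((ρ.π f).le_opNorm ξ).trans ?_
  gcongr
  have h1 : ‖ρ.π f‖ ≤ ‖f‖ := NonUnitalStarAlgHom.norm_apply_le ρ.π _
  exact h1.trans ((ContinuousMap.norm_le _ hε).mpr hf)

open Classical in
/-- The matrix coefficients of `L(f)` are bounded by the supremum norm of `f`. -/
theorem norm_regFun_single_le {α : 𝒢.Action X} (f : α.Section) {ε : ℝ} (hε : 0 ≤ ε)
    (hf : ∀ k y, ‖f.toFun k y‖ ≤ ε) (p q : α.RegIndex) (ξ : p.rep.H) :
    ‖regFun f (lp.single 2 p ξ : α.RegSpace) q‖ ≤ ε * ‖ξ‖ := by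
  have hz : ∀ t : {t : G // 𝒢.r t = 𝒢.r q.g}, q.shift t.1 t.2 ≠ p →
      q.rep.π (α.pull q.g q.hg t.2.symm (f.toFun t.1))
        ((lp.single 2 p ξ : α.RegSpace) (q.shift t.1 t.2)) = 0 := fun t ht => by
    rw [lp.single_apply_ne _ _ _ ht]
    exact map_zero _
  -- Cancellation in the groupoid allows at most one `t` with `t⁻¹ q = p`, so at most one term of
  -- the sum survives.
  by_cases h : ∃ t : {t : G // 𝒢.r t = 𝒢.r q.g}, q.shift t.1 t.2 = p
  · obtain ⟨t, ht⟩ := h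
    have h1 := finsum_eq_single (fun t : {t : G // 𝒢.r t = 𝒢.r q.g} =>
      q.rep.π (α.pull q.g q.hg t.2.symm (f.toFun t.1))
        ((lp.single 2 p ξ : α.RegSpace) (q.shift t.1 t.2))) t fun t' ht' =>
      hz t' fun h => ht' (Subtype.ext (q.shift_injective _ _ (h.trans ht.symm)))
    unfold regFun
    rw [h1]
    refine (q.rep.norm_π_apply_le _ hε (fun x => hf _ _) _).trans ?_
    gcongr
    refine (lp.norm_apply_le_norm two_ne_zero (lp.single 2 p ξ : α.RegSpace) _).trans_eq ?_
    exact α.norm_single p ξ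
  · push Not at h
    have : regFun f (lp.single 2 p ξ : α.RegSpace) q = 0 :=
      (finsum_congr fun t => hz t (h t)).trans finsum_zero
    rw [this, norm_zero]
    positivity

/-- In the sum at `k` the vector is evaluated at `t⁻¹ k`, which is the unit only for `t = k`. Thus
every value of a section is a coefficient of some `L(f) δ_x`. -/
theorem regFun_pointVector {α : 𝒢.Action X} (f : α.Section) (x : X) (k : G)
    (hk : 𝒢.s k = α.rX x) :
    regFun f (α.pointVector x) ⟨α.pointRep x, k, hk⟩ = f.toFun k ⟨α.act k x, α.rX_act k x hk⟩ := by
  unfold regFun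
  rw [finsum_eq_single _ (⟨k, rfl⟩ : {t : G // 𝒢.r t = 𝒢.r k})]
  · have : α.pointVector x (RegIndex.shift ⟨α.pointRep x, k, hk⟩ k rfl) = (1 : ℂ) := by
      refine (apply_regIndex_congr (α.pointVector x) (α.pointRep x)
        (g' := 𝒢.unit (α.rX x)) ?_ _ (𝒢.s_unit _)).trans ?_
      · exact (𝒢.inv_mul k).trans (by rw [hk])
      · exact α.pointVector_apply_self x
    rw [this]
    refine (pointRep_π_apply α x _ _).trans ?_
    exact mul_one (M := ℂ) _
  · intro t ht
    have : α.pointVector x (RegIndex.shift ⟨α.pointRep x, k, hk⟩ t.1 t.2) = (0 : ℂ) := by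
      refine α.pointVector_apply_ne x fun h => ht (Subtype.ext ?_)
      have h1 : 𝒢.mul (𝒢.inv t.1) k = 𝒢.unit (α.rX x) := congrArg RegIndex.g h
      refine 𝒢.inv_mul_injective t.2 rfl (h1.trans ?_)
      rw [𝒢.inv_mul, hk]
    rw [this]
    exact map_zero _

variable [T2Space X]

/-- The restriction of `f` to the units is the diagonal coefficient of `L(f)` at `δ_x`, a unit
vector, so the expectation is contractive. -/
theorem norm_toFun_sub_inner_le {α : 𝒢.Action X} (f : α.Section)
    (T : α.RegSpace →L[ℂ] α.RegSpace) (x : X) :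
    ‖f.toFun (𝒢.unit (α.rX x)) ⟨x, (𝒢.r_unit _).symm⟩
      - inner ℂ (α.pointVector x) (T (α.pointVector x))‖ ≤ ‖regRep α f - T‖ := by
  have h1 : f.toFun (𝒢.unit (α.rX x)) ⟨x, (𝒢.r_unit _).symm⟩ =
      inner ℂ (α.pointVector x) (regRep α f (α.pointVector x)) := by
    have h2 := regFun_pointVector f x (𝒢.unit (α.rX x)) (𝒢.s_unit _)
    simp only [α.unit_act] at h2
    rw [← h2]
    classical
    refine Eq.trans ?_ (lp.inner_single_left (G := fun p : α.RegIndex => p.rep.H) (𝕜 := ℂ)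
      (α.pointIndex x) (1 : ℂ) (regRep α f (α.pointVector x))).symm
    refine Eq.trans ?_ (RCLike.inner_apply (𝕜 := ℂ) _ _).symm
    rw [map_one]
    exact (mul_one (M := ℂ) _).symm
  rw [h1, ← inner_sub_right, ← sub_apply]
  refine (norm_inner_le_norm _ _).trans ?_
  rw [norm_pointVector, one_mul]
  refine (ContinuousLinearMap.le_opNorm _ _).trans ?_
  rw [norm_pointVector, mul_one]

/-- The conditional expectation onto `C(X)` is faithful: an element of the closure of
`Γ_c(G, r⋆𝒜)` that annihilates all unit vectors at units vanishes. -/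
theorem eq_zero_of_apply_pointVector_eq_zero {α : 𝒢.Action X} {T : α.RegSpace →L[ℂ] α.RegSpace}
    (hT : T ∈ closure (range (regRep α))) (h0 : ∀ x, T (α.pointVector x) = 0) : T = 0 := by
  classical
  have key : ∀ ε > 0, ∀ (p q : α.RegIndex) (ξ : p.rep.H),
      ‖(T (lp.single 2 p ξ) : α.RegSpace) q‖ ≤ (2 * ‖ξ‖) * ε := by
    intro ε hε p q ξ
    obtain ⟨_, ⟨f, rfl⟩, hf⟩ := Metric.mem_closure_iff.mp hT ε hε
    rw [dist_eq_norm] at hf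
    -- The value at `(k, y)` is a coefficient of `L(f) δ_x` for `x = k⁻¹ y`. Since `T δ_x = 0`, it
    -- is bounded by `‖(T - L(f)) δ_x‖ ≤ ε`.
    have hfε : ∀ k y, ‖f.toFun k y‖ ≤ ε := by
      rintro k ⟨y, hy⟩
      have hs : 𝒢.s k = α.rX (α.act (𝒢.inv k) y) := by
        rw [α.rX_act _ _ ((𝒢.s_inv k).trans hy.symm), 𝒢.r_inv]
      have h1 := regFun_pointVector f (α.act (𝒢.inv k) y) k hs
      simp only [α.act_inv_act hy.symm] at h1
      rw [← h1]
      refine (lp.norm_apply_le_norm two_ne_zero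
        (regRep α f (α.pointVector (α.act (𝒢.inv k) y))) _).trans ?_
      have h2 := (T - regRep α f).le_opNorm (α.pointVector (α.act (𝒢.inv k) y))
      rw [sub_apply, h0, zero_sub, norm_neg, norm_pointVector, mul_one] at h2
      exact h2.trans hf.le
    have h3 := norm_regFun_single_le f hε.le hfε p q ξ
    have h4 : ‖((T - regRep α f) (lp.single 2 p ξ) : α.RegSpace) q‖ ≤ ε * ‖ξ‖ := by
      refine (lp.norm_apply_le_norm two_ne_zero _ _).trans ?_
      refine ((T - regRep α f).le_opNorm _).trans ?_
      rw [α.norm_single]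
      gcongr
    have h5 : (T (lp.single 2 p ξ) : α.RegSpace) q =
        ((T - regRep α f) (lp.single 2 p ξ) : α.RegSpace) q +
          regFun f (lp.single 2 p ξ : α.RegSpace) q := by
      rw [← regRep_apply, ← Pi.add_apply, ← lp.coeFn_add, sub_apply, sub_add_cancel]
    rw [h5]
    refine (norm_add_le _ _).trans ?_
    linarith
  have hs : ∀ p ξ, T (lp.single 2 p ξ) = 0 := fun p ξ => lp.ext <| funext fun q => by
    refine norm_le_zero_iff.mp (le_of_forall_pos_le_add fun ε hε => ?_)
    refine (key (ε / (2 * ‖ξ‖ + 1)) (by positivity) p q ξ).trans ?_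
    rw [zero_add, mul_div_assoc', div_le_iff₀ (by positivity)]
    nlinarith
  -- Every vector is the norm-convergent sum of its coordinates, each of which `T` kills.
  ext1 h
  have := (lp.hasSum_single (by norm_num) h).mapL T
  simp only [hs] at this
  exact this.unique hasSum_zero

end Coefficients

end Action
end EtaleGroupoid

/-! ### Cutting sections down to the diagonal -/

namespace EtaleGroupoid
namespace Action

section Diagonal

variable {G G₀ X : Type*} [TopologicalSpace G] [TopologicalSpace G₀] [TopologicalSpace X]
  {𝒢 : EtaleGroupoid G G₀}

theorem apply_shift_unit {α : 𝒢.Action X} (h : ∀ p : α.RegIndex, p.rep.H) (p : α.RegIndex) :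
    (show p.rep.H from h (p.shift (𝒢.unit (𝒢.r p.g)) (𝒢.r_unit _))) = h p :=
  apply_regIndex_congr h p.rep (by rw [𝒢.inv_unit, 𝒢.unit_mul]) _ _

/-- The function `a ∈ C(X)`, restricted to the range fibre of the arrow of an index and moved to its
source fibre. -/
noncomputable def pullFunction (α : 𝒢.Action X) (a : C(X, ℂ)) (p : α.RegIndex) :
    C(α.Fibre p.rep.u, ℂ) :=
  α.pull p.g p.hg rfl (α.restr a (𝒢.r p.g))

theorem pullFunction_apply (α : 𝒢.Action X) (a : C(X, ℂ)) (p : α.RegIndex)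
    (x : α.Fibre p.rep.u) : α.pullFunction a p x = a (α.act p.g x.1) := rfl

variable [CompactSpace X] [T2Space G₀]

/-- Tietze extends the value of `f` at the unit of `x` to some `a ∈ C(X)`. Continuity of `f` into
the bundle keeps it in the tube of radius `δ/2` around `a`, and `a` itself varies by less than `δ/2`
near `x`. -/
theorem eventually_norm_toFun_unit_sub_lt [T2Space X] {α : 𝒢.Action X} (f : α.Section) (x : X)
    {δ : ℝ} (hδ : 0 < δ) :
    ∀ᶠ y in 𝓝 x, ‖f.toFun (𝒢.unit (α.rX y)) ⟨y, (𝒢.r_unit _).symm⟩ -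
      f.toFun (𝒢.unit (α.rX x)) ⟨x, (𝒢.r_unit _).symm⟩‖ < δ := by
  obtain ⟨a, ha⟩ := ContinuousMap.exists_restrict_eq
    (α.isClosed_fibre (𝒢.r (𝒢.unit (α.rX x)))) (f.toFun (𝒢.unit (α.rX x)))
  have ha' : α.restr a _ = f.toFun (𝒢.unit (α.rX x)) := ha
  let W : Set α.Bundle := {b | b.base ∈ (univ : Set G₀) ∧ ‖b.val - α.restr a b.base‖ < δ / 2}
  have hW : IsOpen W := TopologicalSpace.isOpen_generateFrom_of_mem
    ⟨a, univ, δ / 2, isOpen_univ, half_pos hδ, rfl⟩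
  have hc : Continuous fun y => (⟨_, f.toFun (𝒢.unit (α.rX y))⟩ : α.Bundle) :=
    f.continuous_toFun.comp (𝒢.continuous_unit.comp α.continuous_rX)
  have h1 : ∀ᶠ y in 𝓝 x, (⟨_, f.toFun (𝒢.unit (α.rX y))⟩ : α.Bundle) ∈ W :=
    (hW.preimage hc).mem_nhds ⟨mem_univ _, by simpa [ha'] using hδ⟩
  have h2 : ∀ᶠ y in 𝓝 x, ‖a y - a x‖ < δ / 2 := by
    have := Metric.tendsto_nhds.mp (a.continuous.tendsto x) (δ / 2) (half_pos hδ)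
    simpa only [dist_eq_norm] using this
  filter_upwards [h1, h2] with y hy1 hy2
  have h3 := (ContinuousMap.norm_coe_le_norm (f.toFun (𝒢.unit (α.rX y)) -
    α.restr a (𝒢.r (𝒢.unit (α.rX y)))) ⟨y, (𝒢.r_unit _).symm⟩).trans_lt hy1.2
  have h4 : f.toFun (𝒢.unit (α.rX x)) ⟨x, (𝒢.r_unit _).symm⟩ = a x := by
    rw [← ha']; rfl
  rw [h4]
  have h5 := norm_add_le (f.toFun (𝒢.unit (α.rX y)) ⟨y, (𝒢.r_unit _).symm⟩ - a y) (a y - a x)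
  rw [sub_add_sub_cancel] at h5
  have h6 : ‖f.toFun (𝒢.unit (α.rX y)) ⟨y, (𝒢.r_unit _).symm⟩ - a y‖ < δ / 2 := h3
  linarith

/-- Under a free action, every point has a neighbourhood that the non-unital arrows in a given
compact set move off itself. -/
theorem IsFree.exists_mem_nhds [T2Space G] [T2Space X] {α : 𝒢.Action X} (hα : α.IsFree) {K : Set G}
    (hK : IsCompact K) (x : X) :
    ∃ U ∈ 𝓝 x, ∀ k ∈ K, k ∉ range 𝒢.unit → ∀ z ∈ U, 𝒢.s k = α.rX z → α.act k z ∉ U := by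
  -- The units are open, so removing them leaves `S` compact. The set of pairs `(z, k z)` is then
  -- closed in `X × X`, and freeness keeps `(x, x)` out of it.
  set S : Set (G × X) := ((K \ range 𝒢.unit) ×ˢ univ) ∩ {p | 𝒢.s p.1 = α.rX p.2} with hS
  have hSc : IsCompact S :=
    ((hK.diff 𝒢.isOpen_range_unit).prod isCompact_univ).inter_right
      (isClosed_eq (𝒢.isLocalHomeomorph_s.continuous.comp continuous_fst)
        (α.continuous_rX.comp continuous_snd))
  have hcont : ContinuousOn (fun p : G × X => (p.2, α.act p.1 p.2)) S :=
    continuous_snd.continuousOn.prodMk (α.continuousOn_act.mono inter_subset_right)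
  have hx : (x, x) ∉ (fun p : G × X => (p.2, α.act p.1 p.2)) '' S := by
    rintro ⟨⟨k, z⟩, ⟨⟨⟨-, hk⟩, -⟩, hs⟩, he⟩
    obtain ⟨rfl, h2⟩ := Prod.mk.inj he
    exact hk ⟨_, (hα k _ hs h2).symm⟩
  have hn := (hSc.image_of_continuousOn hcont).isClosed.isOpen_compl.mem_nhds hx
  rw [nhds_prod_eq, mem_prod_same_iff] at hn
  obtain ⟨U, hU, hUS⟩ := hn
  refine ⟨U, hU, fun k hk hku z hz hs hkz => ?_⟩
  exact hUS (show (z, α.act k z) ∈ U ×ˢ U from ⟨hz, hkz⟩)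
    ⟨(k, z), ⟨⟨⟨hk, hku⟩, mem_univ _⟩, hs⟩, rfl⟩

variable [T2Space G]

theorem regFun_ofFunction (α : 𝒢.Action X) (a : C(X, ℂ)) (h : ∀ p : α.RegIndex, p.rep.H)
    (p : α.RegIndex) :
    regFun (α.ofFunction a) h p = p.rep.π (α.pullFunction a p) (h p) := by
  unfold regFun
  rw [finsum_eq_single _ (⟨𝒢.unit (𝒢.r p.g), 𝒢.r_unit _⟩ : {t : G // 𝒢.r t = 𝒢.r p.g})]
  · have h1 : α.pull p.g p.hg (𝒢.r_unit _).symm ((α.ofFunction a).toFun (𝒢.unit (𝒢.r p.g))) =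
        α.pullFunction a p := by
      ext x
      simp only [pull, ofFunction, mem_range_self, if_true]
      rfl
    exact congr (congrArg (fun m => ⇑(p.rep.π m)) h1) (apply_shift_unit h p)
  · rintro ⟨t, ht⟩ hne
    have hu : t ∉ range 𝒢.unit := by
      rintro ⟨u, rfl⟩
      refine hne (Subtype.ext ?_)
      exact congrArg 𝒢.unit ((𝒢.r_unit u).symm.trans ht)
    have h1 : α.pull p.g p.hg ht.symm ((α.ofFunction a).toFun t) = 0 := by
      ext x
      simp [pull, ofFunction, hu]
    simp only [h1, map_zero]
    rfl

variable [T2Space X]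

theorem regRep_ofFunction_apply (α : 𝒢.Action X) (a : C(X, ℂ)) (h : α.RegSpace)
    (p : α.RegIndex) :
    regRep α (α.ofFunction a) h p = p.rep.π (α.pullFunction a p) (h p) :=
  α.regFun_ofFunction a h p

theorem regRep_ofFunction_mul (α : 𝒢.Action X) (a b : C(X, ℂ)) :
    regRep α (α.ofFunction (a * b)) = regRep α (α.ofFunction a) * regRep α (α.ofFunction b) := by
  ext1 h
  refine lp.ext (funext fun p => ?_)
  have h1 : α.pullFunction (a * b) p = α.pullFunction a p * α.pullFunction b p := rfl
  rw [mul_apply_eq_comp, regRep_ofFunction_apply, regRep_ofFunction_apply,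
    regRep_ofFunction_apply, h1, map_mul, mul_apply_eq_comp]

theorem regRep_ofFunction_star (α : 𝒢.Action X) (a : C(X, ℂ)) :
    regRep α (α.ofFunction (star a)) = star (regRep α (α.ofFunction a)) := by
  rw [ContinuousLinearMap.star_eq_adjoint, ContinuousLinearMap.eq_adjoint_iff]
  intro h k
  rw [lp.inner_eq_tsum, lp.inner_eq_tsum]
  refine tsum_congr fun p => ?_
  have h1 : α.pullFunction (star a) p = star (α.pullFunction a p) := rfl
  rw [regRep_ofFunction_apply, regRep_ofFunction_apply, h1, map_star,
    ContinuousLinearMap.star_eq_adjoint, ContinuousLinearMap.adjoint_inner_left]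

/-- If `φ` is moved off itself by the non-unital arrows in the support of `f`, then `φ f φ` is the
function `φ² f|_{G⁽⁰⁾}`. -/
theorem regRep_conj_apply {α : 𝒢.Action X} (f : α.Section) (φ : C(X, ℂ))
    (hφ : ∀ k z, 𝒢.s k = α.rX z → f.toFun k ≠ 0 → k ∉ range 𝒢.unit → φ (α.act k z) * φ z = 0)
    (h : α.RegSpace) (p : α.RegIndex) :
    regRep α (α.ofFunction φ) (regRep α f (regRep α (α.ofFunction φ) h)) p =
      p.rep.π (α.pullFunction φ p *
        α.pull p.g p.hg (𝒢.r_unit _).symm (f.toFun (𝒢.unit (𝒢.r p.g))) * α.pullFunction φ p)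
        (h p) := by
  rw [regRep_ofFunction_apply, regRep_apply]
  set k := regRep α (α.ofFunction φ) h with hk
  unfold regFun
  have hm := (p.rep.π (α.pullFunction φ p)).toLinearMap.toAddMonoidHom.map_finsum
    (finite_support_regFun f k p)
  refine hm.trans ?_
  rw [finsum_eq_single _ (⟨𝒢.unit (𝒢.r p.g), 𝒢.r_unit _⟩ : {t : G // 𝒢.r t = 𝒢.r p.g})]
  · have h1 : (show p.rep.H from k (p.shift (𝒢.unit (𝒢.r p.g)) (𝒢.r_unit _))) =
        p.rep.π (α.pullFunction φ p) (h p) :=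
      (apply_shift_unit k p).trans (α.regRep_ofFunction_apply φ h p)
    rw [map_mul, map_mul]
    exact congrArg (fun v => p.rep.π (α.pullFunction φ p) (p.rep.π (α.pull p.g p.hg
      (𝒢.r_unit _).symm (f.toFun (𝒢.unit (𝒢.r p.g)))) v)) h1
  · rintro ⟨t, ht⟩ hne
    have hu : t ∉ range 𝒢.unit := by
      rintro ⟨u, rfl⟩
      refine hne (Subtype.ext ?_)
      exact congrArg 𝒢.unit ((𝒢.r_unit u).symm.trans ht)
    -- The shifted index has the same representation, so its function and vector can be renamed as
    -- objects over `p`, where `π` is multiplicative.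
    obtain ⟨m, v, hm, hkv⟩ : ∃ (m : C(α.Fibre p.rep.u, ℂ)) (v : p.rep.H),
        (∀ x, m x = φ (α.act (𝒢.mul (𝒢.inv t) p.g) x.1)) ∧
          (show p.rep.H from k (p.shift t ht)) = p.rep.π m v :=
      ⟨α.pullFunction φ (p.shift t ht), h (p.shift t ht), fun _ => rfl,
        α.regRep_ofFunction_apply φ h (p.shift t ht)⟩
    -- With `g` the arrow of `p` and `z = t⁻¹ g x`, one has `t z = g x`. Hence the product contains
    -- the factor `φ(t z) φ(z)`, which vanishes if `f(t) ≠ 0`.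
    have h2 : α.pullFunction φ p * α.pull p.g p.hg ht.symm (f.toFun t) * m = 0 := by
      ext x
      have hx : 𝒢.s p.g = α.rX x.1 := p.hg.trans x.2.symm
      by_cases hf : f.toFun t = 0
      · simp [pull, hf]
      · have hs : 𝒢.s (𝒢.inv t) = 𝒢.r p.g := (𝒢.s_inv t).trans ht
        have h3 := hφ t (α.act (𝒢.mul (𝒢.inv t) p.g) x.1) (by
          rw [α.rX_act _ _ ((𝒢.s_mul _ _ hs).trans hx), 𝒢.r_mul _ _ hs, 𝒢.r_inv]) hf hu
        rw [← α.act_act _ _ _ hs hx,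
          α.act_inv_act (ht.trans (α.rX_act _ _ hx).symm), α.act_act _ _ _ hs hx] at h3
        rw [ContinuousMap.mul_apply, ContinuousMap.mul_apply, hm, pullFunction_apply,
          mul_right_comm, h3, zero_mul]
        rfl
    have h4 := congrArg (fun m => p.rep.π m v) h2
    simp only [map_mul, map_zero] at h4
    exact (congrArg (fun v => p.rep.π (α.pullFunction φ p) (p.rep.π (α.pull p.g p.hg
      ht.symm (f.toFun t)) v)) hkv).trans h4

/-- After compression by `φ` the operator is diagonal: each coordinate is acted on by a translate of
`φ² (f|_{G⁽⁰⁾} - μ)`, whose supremum norm is at most `δ`. -/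
theorem norm_regRep_conj_sub_le {α : 𝒢.Action X} (f : α.Section) (φ : C(X, ℂ))
    (hφ : ∀ k z, 𝒢.s k = α.rX z → f.toFun k ≠ 0 → k ∉ range 𝒢.unit → φ (α.act k z) * φ z = 0)
    (hφ1 : ∀ y, ‖φ y‖ ≤ 1) (μ : ℂ) {δ : ℝ} (hδ : 0 ≤ δ)
    (hμ : ∀ y, φ y ≠ 0 → ‖f.toFun (𝒢.unit (α.rX y)) ⟨y, (𝒢.r_unit _).symm⟩ - μ‖ ≤ δ)
    (h : α.RegSpace) :
    ‖regRep α (α.ofFunction φ) ((regRep α f - μ • 1) (regRep α (α.ofFunction φ) h))‖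
      ≤ δ * ‖h‖ := by
  rw [← Real.norm_of_nonneg hδ, ← norm_smul]
  refine lp.norm_mono two_ne_zero fun p => ?_
  have h1 : (regRep α (α.ofFunction φ) ((regRep α f - μ • 1) (regRep α (α.ofFunction φ) h))) p =
      p.rep.π (α.pullFunction φ p *
        (α.pull p.g p.hg (𝒢.r_unit _).symm (f.toFun (𝒢.unit (𝒢.r p.g))) - μ • 1) *
          α.pullFunction φ p) (h p) := by
    rw [sub_apply, map_sub, lp.coeFn_sub, Pi.sub_apply, regRep_conj_apply f φ hφ]
    rw [smul_apply, map_smul, lp.coeFn_smul, Pi.smul_apply, one_apply_eq_self,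
      regRep_ofFunction_apply, regRep_ofFunction_apply, mul_sub, sub_mul, map_sub, sub_apply,
      mul_smul_comm, mul_one, smul_mul_assoc, map_smul, map_mul _ (α.pullFunction φ p)]
    rfl
  rw [h1, lp.coeFn_smul, Pi.smul_apply, norm_smul, Real.norm_of_nonneg hδ]
  refine p.rep.norm_π_apply_le _ hδ (fun x => ?_) _
  have hx : 𝒢.s p.g = α.rX x.1 := p.hg.trans x.2.symm
  set y := α.act p.g x.1 with hy
  have hr : α.rX y = 𝒢.r p.g := α.rX_act _ _ hx
  -- The unit occurs in the type of the fibre point, so it is replaced by an equal one through a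
  -- general `u`.
  have h2 : ∀ u (hu : α.rX y = u), f.toFun (𝒢.unit u) ⟨y, hu.trans (𝒢.r_unit _).symm⟩ =
      f.toFun (𝒢.unit (α.rX y)) ⟨y, (𝒢.r_unit _).symm⟩ := by
    rintro _ rfl; rfl
  have h3 : (α.pullFunction φ p *
      (α.pull p.g p.hg (𝒢.r_unit _).symm (f.toFun (𝒢.unit (𝒢.r p.g))) - μ • 1) *
        α.pullFunction φ p) x =
      φ y * (f.toFun (𝒢.unit (α.rX y)) ⟨y, (𝒢.r_unit _).symm⟩ - μ) * φ y := by
    rw [← h2 _ hr]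
    change φ y * (_ - μ * 1) * φ y = _
    rw [mul_one]
    rfl
  rw [h3]
  by_cases h0 : φ y = 0
  · simpa [h0] using hδ
  · rw [norm_mul, norm_mul]
    have := hφ1 y
    have := hμ y h0
    calc _ ≤ 1 * δ * 1 := by gcongr
      _ = δ := by ring

end Diagonal

end Action
end EtaleGroupoid

/-! ### The lower bound `ψ T ψ ≥ κ ψ²` -/

namespace EtaleGroupoid
namespace Action

section Compression

variable {G G₀ X : Type*} [TopologicalSpace G] [TopologicalSpace G₀] [TopologicalSpace X]
  {𝒢 : EtaleGroupoid G G₀} [T2Space G₀] [CompactSpace X] [T2Space X]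

/-- By faithfulness some `T δ_x` is nonzero. Then `c δ_x ≠ 0`, and the coefficient is `‖c δ_x‖²`. -/
theorem exists_inner_pointVector_pos {α : 𝒢.Action X} {T c : α.RegSpace →L[ℂ] α.RegSpace}
    (hT : T ∈ closure (range (regRep α))) (hc : T = star c * c) (h0 : T ≠ 0) :
    ∃ (x : X) (μ : ℝ), 0 < μ ∧ inner ℂ (α.pointVector x) (T (α.pointVector x)) = (μ : ℂ) := by
  obtain ⟨x, hx⟩ : ∃ x, T (α.pointVector x) ≠ 0 := by
    by_contra! h
    exact h0 (eq_zero_of_apply_pointVector_eq_zero hT h)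
  have hTv : T (α.pointVector x) = c.adjoint (c (α.pointVector x)) := by rw [hc]; rfl
  refine ⟨x, ‖c (α.pointVector x)‖ ^ 2, ?_, ?_⟩
  · have : c (α.pointVector x) ≠ 0 := fun h => hx (by rw [hTv, h, map_zero])
    positivity
  · rw [hTv, ContinuousLinearMap.adjoint_inner_right, inner_self_eq_norm_sq_to_K]
    norm_cast

/-- For every nonzero positive `T` in the closure of `Γ_c(G, r⋆𝒜)` there are a nonzero real
function `ψ ∈ C(X)` and `κ > 0` with `κ ψ² ≤ ψ T ψ`. -/
theorem exists_smul_sq_le_conj [T2Space G] {α : 𝒢.Action X} (hα : α.IsFree)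
    {T c : α.RegSpace →L[ℂ] α.RegSpace} (hT : T ∈ closure (range (regRep α)))
    (hc : T = star c * c) (h0 : T ≠ 0) :
    ∃ (ψ : C(X, ℂ)) (κ : ℝ), star ψ = ψ ∧ ψ ≠ 0 ∧ 0 < κ ∧
      (κ : ℂ) • (regRep α (α.ofFunction ψ) * regRep α (α.ofFunction ψ)) ≤
        regRep α (α.ofFunction ψ) * T * regRep α (α.ofFunction ψ) := by
  obtain ⟨x, μ, hμ, hx⟩ := exists_inner_pointVector_pos hT hc h0
  obtain ⟨_, ⟨f, rfl⟩, hf⟩ := Metric.mem_closure_iff.mp hT (μ / 4) (by positivity)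
  rw [dist_comm, dist_eq_norm] at hf
  have hfx := (norm_toFun_sub_inner_le f T x).trans hf.le
  rw [hx] at hfx
  obtain ⟨U, hU, hUf⟩ := hα.exists_mem_nhds f.isCompact_support x
  obtain ⟨V, hVsub, hV, hxV⟩ := mem_nhds_iff.mp
    (inter_mem hU (eventually_norm_toFun_unit_sub_lt f x (δ := μ / 4) (by positivity)))
  obtain ⟨χ, hχ0, hχ1, hχ⟩ := exists_continuous_zero_one_of_isClosed hV.isClosed_compl
    (isClosed_singleton (x := x)) (disjoint_singleton_right.mpr (not_not.mpr hxV))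
  -- Both functions come from one Urysohn function `χ`: `ψ` is nonzero only where `χ > 1/2`, and
  -- there `φ = 1`.
  set φ : C(X, ℂ) := ⟨fun y => ((min (2 * χ y) 1 : ℝ) : ℂ), by fun_prop⟩ with hφ
  set ψ : C(X, ℂ) := ⟨fun y => ((max (2 * χ y - 1) 0 : ℝ) : ℂ), by fun_prop⟩ with hψ
  have hφψ : φ * ψ = ψ := by
    ext y
    change ((min (2 * χ y) 1 : ℝ) : ℂ) * ((max (2 * χ y - 1) 0 : ℝ) : ℂ) =
      ((max (2 * χ y - 1) 0 : ℝ) : ℂ)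
    rcases le_total (2 * χ y) 1 with h | h
    · rw [max_eq_right (by linarith)]; simp
    · rw [min_eq_right h]; simp
  have hstar : ∀ (g : X → ℝ) (hg : Continuous fun y => (g y : ℂ)),
      star (⟨fun y => (g y : ℂ), hg⟩ : C(X, ℂ)) = ⟨fun y => (g y : ℂ), hg⟩ := fun g hg => by
    ext y; exact Complex.conj_ofReal _
  have hφs : star φ = φ := hstar _ _
  have hψs : star ψ = ψ := hstar _ _
  have hφV : ∀ y, φ y ≠ 0 → y ∈ V := fun y hy => by
    by_contra h
    refine hy ?_
    have : χ y = 0 := hχ0 h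
    change ((min (2 * χ y) 1 : ℝ) : ℂ) = 0
    simp [this]
  have hφ1 : ∀ y, ‖φ y‖ ≤ 1 := fun y => by
    change ‖((min (2 * χ y) 1 : ℝ) : ℂ)‖ ≤ 1
    have := (hχ y).1
    rw [Complex.norm_real, Real.norm_of_nonneg (by positivity)]
    exact min_le_right _ _
  have hψ0 : ψ ≠ 0 := fun h => by
    have h1 : χ x = 1 := hχ1 rfl
    have h2 : ((max (2 * χ x - 1) 0 : ℝ) : ℂ) = 0 := DFunLike.congr_fun h x
    rw [h1] at h2
    norm_num at h2
  -- On `V` the section at units is within `μ/4` of its value at `x`, which is within `μ/4` of `μ`;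
  -- hence `δ = μ/2`.
  have hconj := norm_regRep_conj_sub_le f φ (fun k z hs hk hu => by
    by_contra h
    have h1 := hVsub (hφV _ (left_ne_zero_of_mul h))
    have h2 := hVsub (hφV _ (right_ne_zero_of_mul h))
    exact hUf k (subset_closure hk) hu z h2.1 hs h1.1) hφ1 (μ : ℂ) (δ := μ / 2) (by positivity)
    (fun y hy => by
      have h1 : ‖_ - _‖ < μ / 4 := (hVsub (hφV y hy)).2
      have h2 := norm_add_le_of_le h1.le hfx
      rw [sub_add_sub_cancel] at h2
      linarith)
  -- What remains of `μ` after the losses `μ/4` (from `T - L(f)`) and `μ/2` (from `L(f) - μ`).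
  refine ⟨ψ, μ / 4, hψs, hψ0, by positivity, ?_⟩
  set E := regRep α (α.ofFunction ψ) with hE
  set Φ := regRep α (α.ofFunction φ) with hΦ
  have hEs : IsSelfAdjoint E := by
    rw [IsSelfAdjoint, hE, ← regRep_ofFunction_star, hψs]
  have hΦs : IsSelfAdjoint Φ := by
    rw [IsSelfAdjoint, hΦ, ← regRep_ofFunction_star, hφs]
  have hΦE : Φ * E = E := by rw [hΦ, hE, ← regRep_ofFunction_mul, hφψ]
  have hTs : IsSelfAdjoint T := hc ▸ IsSelfAdjoint.star_mul_self c
  rw [ContinuousLinearMap.le_def, ContinuousLinearMap.isPositive_def']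
  refine ⟨?_, fun h => ?_⟩
  · refine IsSelfAdjoint.sub ?_ (IsSelfAdjoint.smul (Complex.conj_ofReal _) ?_)
    · simpa only [hEs.star_eq] using hTs.conjugate E
    · simpa only [hEs.star_eq] using IsSelfAdjoint.mul_star_self E
  · set k := E h with hk
    have hΦk : Φ k = k := DFunLike.congr_fun hΦE h
    have hadj : ∀ {S : α.RegSpace →L[ℂ] α.RegSpace}, IsSelfAdjoint S → ∀ v w,
        inner ℂ (S v) w = inner ℂ v (S w) := fun {S} hS v w => by
      rw [← ContinuousLinearMap.adjoint_inner_right, ← ContinuousLinearMap.star_eq_adjoint,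
        hS.star_eq]
    have h1 : (E * T * E - ((μ / 4 : ℝ) : ℂ) • (E * E)).reApplyInnerSelf h =
        (inner ℂ (T k) k).re - μ / 4 * ‖k‖ ^ 2 := by
      rw [ContinuousLinearMap.reApplyInnerSelf_apply, sub_apply, inner_sub_left]
      change (inner ℂ (E (T k)) h - inner ℂ (((μ / 4 : ℝ) : ℂ) • E k) h).re = _
      rw [hadj hEs, ← hk, Complex.sub_re, inner_smul_left, hadj hEs, ← hk,
        Complex.conj_ofReal, Complex.re_ofReal_mul, inner_self_eq_norm_sq_to_K]
      norm_cast
    have h2 : T k = (T - regRep α f) k + (regRep α f - (μ : ℂ) • 1) k + (μ : ℂ) • k := by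
      simp only [sub_apply, smul_apply, one_apply_eq_self]
      abel
    have h3 : ‖inner ℂ ((T - regRep α f) k) k‖ ≤ μ / 4 * ‖k‖ ^ 2 := by
      refine (norm_inner_le_norm _ _).trans ?_
      rw [sq, ← _root_.mul_assoc]
      gcongr
      refine ((T - regRep α f).le_opNorm k).trans ?_
      rw [norm_sub_rev]
      gcongr
    have h4 : ‖inner ℂ ((regRep α f - (μ : ℂ) • 1) k) k‖ ≤ μ / 2 * ‖k‖ ^ 2 := by
      -- Since `k = Φ k`, the compressed estimate for `Φ (L(f) - μ) Φ` controls the form of `L(f) -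
      -- μ` at `k`.
      nth_rw 2 [← hΦk]
      rw [← hadj hΦs]
      nth_rw 1 [← hΦk]
      refine (norm_inner_le_norm _ _).trans ?_
      rw [sq, ← _root_.mul_assoc]
      gcongr
      exact hconj k
    have h5 : (inner ℂ ((μ : ℂ) • k) k).re = μ * ‖k‖ ^ 2 := by
      rw [inner_smul_left, Complex.conj_ofReal, Complex.re_ofReal_mul,
        inner_self_eq_norm_sq_to_K]
      norm_cast
    rw [h1, h2, inner_add_left, inner_add_left, Complex.add_re, Complex.add_re, h5]
    have h6 := (abs_le.mp ((Complex.abs_re_le_norm _).trans h3)).1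
    have h7 := (abs_le.mp ((Complex.abs_re_le_norm _).trans h4)).1
    linarith

end Compression

end Action
end EtaleGroupoid

/-! ### From the lower bound to Cuntz subequivalence -/

theorem cuntzSubequiv_of_smul_sq_le {A : Type*} [CStarAlgebra A] [PartialOrder A]
    [StarOrderedRing A] {S : StarSubalgebra ℂ A} (B : Subalgebra ℂ S) {e a : S} (heB : e ∈ B)
    (haB : a ∈ B) (he : IsSelfAdjoint e) {κ : ℝ} (hκ : 0 < κ)
    (hle : (κ : ℂ) • ((e : A) * (e : A)) ≤ (e : A) * (a : A) * (e : A)) :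
    CuntzSubequiv B (e * e) a := by
  have he' : IsSelfAdjoint (e : A) := congrArg Subtype.val he.star_eq
  set y : S := e * a * e with hy
  have hyB : y ∈ B := B.mul_mem (B.mul_mem heB haB) heB
  have hq : ∀ n : ℕ, ∃ q ∈ B, star q = q ∧
      ‖e * (q * y * q) * e - e * e‖ < 1 / ((n : ℝ) + 1) := by
    intro n
    obtain ⟨p, hps, hp⟩ := exists_isSelfAdjoint_aeval_conj_near he' hκ hle
      (ε := 1 / ((n : ℝ) + 1)) (by positivity)
    -- The estimate is made in `A`, where functional calculus is available; polynomials commute with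
    -- the inclusion of `S`.
    have hval : ((Polynomial.aeval y p : S) : A) =
        Polynomial.aeval ((e : A) * (a : A) * (e : A)) p :=
      (Polynomial.aeval_algHom_apply S.subtype.toAlgHom y p).symm
    refine ⟨Polynomial.aeval y p, ?_, Subtype.ext ?_, ?_⟩
    · exact Algebra.adjoin_le (singleton_subset_iff.mpr hyB)
        (Polynomial.aeval_mem_adjoin_singleton ℂ y)
    · exact (congrArg star hval).trans (hps.star_eq.trans hval.symm)
    · rw [← hval] at hp
      exact hp
  choose q hqB hqs hq using hq
  -- With `e` and `qₙ` self-adjoint, `rₙ a rₙ⋆ = e qₙ (e a e) qₙ e = e qₙ y qₙ e`.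
  refine ⟨fun n => e * q n * e, fun n => B.mul_mem (B.mul_mem heB (hqB n)) heB, ?_⟩
  rw [tendsto_iff_norm_sub_tendsto_zero]
  refine squeeze_zero (fun _ => norm_nonneg _) (fun n => ?_) tendsto_one_div_add_atTop_nhds_zero_nat
  refine le_of_eq_of_le ?_ (hq n).le
  rw [star_mul, star_mul, he.star_eq, hqs, hy]
  simp only [mul_assoc]

theorem mainTheorem8 {G G₀ X : Type*}
    [TopologicalSpace G] [T2Space G] [LocallyCompactSpace G]
    [TopologicalSpace G₀] [T2Space G₀]
    [TopologicalSpace X] [CompactSpace X] [T2Space X]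
    (𝒢 : EtaleGroupoid G G₀) (α : 𝒢.Action X) (hfree : α.IsFree)
    (B : Subalgebra ℂ α.crossedProduct)
    (hCX : ∀ f : C(X, ℂ), α.incl f ∈ B)
    (hdense : ∀ b ∈ B, b ∈ closure ((B : Set α.crossedProduct) ∩ Set.range α.ofSection))
    (a : α.crossedProduct) (haB : a ∈ B) (ha : IsPositiveElem a) (ha0 : a ≠ 0) :
    ∃ b : C(X, ℂ), IsPositiveElem b ∧ b ≠ 0 ∧ CuntzSubequiv B (α.incl b) a := by
  obtain ⟨c, hc⟩ := ha
  have hcl : (a : α.RegSpace →L[ℂ] α.RegSpace) ∈ closure (range (α.regRep)) := by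
    refine map_mem_closure continuous_subtype_val (hdense a haB) ?_
    rintro _ ⟨-, f, rfl⟩
    exact ⟨f, rfl⟩
  obtain ⟨ψ, κ, hψs, hψ0, hκ, hle⟩ := EtaleGroupoid.Action.exists_smul_sq_le_conj hfree hcl
    (c := c) (congrArg Subtype.val hc) fun h => ha0 (Subtype.ext h)
  have hes : IsSelfAdjoint (α.incl ψ) :=
    Subtype.ext ((α.regRep_ofFunction_star ψ).symm.trans (by rw [hψs]; rfl))
  refine ⟨ψ * ψ, ⟨ψ, by rw [hψs]⟩, ?_, ?_⟩
  · obtain ⟨x, hx⟩ := DFunLike.ne_iff.mp hψ0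
    exact DFunLike.ne_iff.mpr ⟨x, mul_ne_zero hx hx⟩
  · have hmul : α.incl (ψ * ψ) = α.incl ψ * α.incl ψ :=
      Subtype.ext (α.regRep_ofFunction_mul ψ ψ)
    rw [hmul]
    exact cuntzSubequiv_of_smul_sq_le B (hCX ψ) haB hes hκ hle
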